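/- **Model.** Let $d>0$ be the maximum message delay (the time unit) and $\vartheta>1$. The $n$ nodes of a fully connected network have clocks $C_v$ with $t'-t\le C_v(t')-C_v(t)\le\vartheta(t'-t)$ for $t<t'$. An algorithm consists of finite sets of states (non-empty), pulse states, messages and timers, a transition function, and a message function; a message is a tuple of finitely many symbols, one for each of the parallel *message streams* of a channel. When the message function of sender $v$ for receiver $u$ has value $m$ at time $t$, the channel from $v$ to $u$ holds $m$ at time $d_{uv}(t)$, where $d_{uv}$ is continuous, strictly increasing and $t<d_{uv}(t)<t+d$. A node updates its state by the transition function (applied to its state, the most recent messages from all nodes, and the set of expired timers) whenever its input channels change or one of its timers expires, at least once during $(0,d]$, and possibly at further times chosen by the adversary (finitely many in bounded time). A timer of length $T_k$ is reset to $T_k$ when the node *transitions to* (that is, changes its state into) one of the states associated with the timer, and then runs down on the local clock. A node generates a pulse when it transitions to a pulse state. The adversary chooses the set $F$ of faulty nodes, all local configurations and channel contents at time $0$, the clocks, the delays and all messages of faulty nodes; all these signals are piecewise constant. The nodes outside $F$ are correct. An algorithm is an *$f$-resilient pulse synchronisation algorithm* with skew $\sigma$, accuracy $(\Phi^-,\Phi^+)$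 and stabilisation time $\tau$ if in every execution with $|F|\le f$ there is $t\in[0,\tau]$ such that the $k$th pulse at or after $t$ of each correct node $v$ exists for all $k\ge1$, at a time $p_k(v)$, and for all correct $u,v$ and all $k\ge 1$: $p_1(v)\le t+\Phi^+$, $|p_k(v)-p_k(u)|<\sigma$, and $\Phi^-\le p_{k+1}(v)-\min_w p_k(w)\le\Phi^+$ (minimum over correct $w$). It is an *$f$-resilient resynchronisation algorithm* with skew $\rho$, separation window $\Psi$ and stabilisation time $\tau$ if in every execution with $|F|\le f$ there is $t\in[0,\tau]$ such that every correct node generates exactly one pulse in $[t,t+\rho+\Psi)$, and this pulse lies in $[t,t+\rho)$. For an algorithm $\mathbf A$ let $M(\mathbf A)\in\mathbb N\cup\{\infty\}$ be the maximum number of bits that a correct node sends on a channel during an interval $[t,t+d)$, $t\ge 0$, over all executions (with any set $F$); a symbol is sent on a stream whenever the value to be transmitted changes, and this costs $\lceil\log_2 N\rceil$ bits if $N$ different symbols can occur on this stream of this channel. Let $k(\mathbf A)$ be its number of streams per channel. **Theorem.** Let $1<\vartheta\le 1.004$ and $\varphi_0(\vartheta)=1+5(\vartheta-1)/(2+2\vartheta-3\vartheta^2)$.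 There are $\varphi_1>\varphi_0(\vartheta)$ and constants $C_\rho\in\mathbb R$, $K\in\mathbb N$, depending only on $\vartheta$, such that for all $\varphi\in(\varphi_0(\vartheta),\varphi_1)$ and all $\psi_0,c>0$ there are constants $C_T,C_S$ (depending only on $\vartheta,\varphi,\psi_0,c$) with the following property. Let $d>0$, $\Psi\ge\psi_0 d$ and $0<T_0\le c\Psi$; let $f\ge1$, $f_0=\lfloor(f-1)/2\rfloor$, $f_1=\lceil(f-1)/2\rceil$, and let $n=n_0+n_1$ with $n>3f$, $n_0>3f_0$ and $n_1>3f_1$. Suppose that for $i\in\{0,1\}$ and every $T\in[T_0,C_T\Psi]$, $\mathbf A_i^T$ is an $f_i$-resilient pulse synchronisation algorithm on $n_i$ nodes with skew $2d$, accuracy $(T,\varphi T)$ and stabilisation time $\tau_i(T)$. Then there are $S_0,S_1\in[T_0,C_T\Psi]$ and an $f$-resilient resynchronisation algorithm $\mathbf B$ on the $n$ nodes (two disjoint blocks of $n_0$ and $n_1$ nodes) with skew $\rho$ for some $0<\rho\le C_\rho d$, separation window $\Psi$ and stabilisation time $\max\{\tau_0(S_0),\tau_1(S_1)\}+C_S\Psi$,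 such that $M(\mathbf B)\le\max\{M(\mathbf A_0^{S_0}),M(\mathbf A_1^{S_1})\}+K$ and $k(\mathbf B)\le\max\{k(\mathbf A_0^{S_0}),k(\mathbf A_1^{S_1})\}+K$. -/

import Mathlib

open Set Filter Topology

/-! ### Signals: piecewise constant functions of reference time -/

/-- `g` is constantly equal to `a` immediately before time `t`. -/
def JustBefore {α : Type} (g : ℝ → α) (t : ℝ) (a : α) : Prop :=
  ∀ᶠ t' in 𝓝[<] t, g t' = a

/-- A signal on `[0, ∞)`: right-continuous and piecewise constant, with only finitely many changes
in every bounded time interval. -/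
def IsSignal {α : Type} (g : ℝ → α) : Prop :=
  (∀ t, 0 ≤ t → ∀ᶠ t' in 𝓝[>] t, g t' = g t) ∧ ∀ t, 0 < t → ∃ a, JustBefore g t a

/-- The signal `g` changes its value at time `t > 0` (its value at `t` is the new one). -/
def ChangesAt {α : Type} (g : ℝ → α) (t : ℝ) : Prop :=
  0 < t ∧ ¬ JustBefore g t (g t)

/-! ### Algorithms -/

/-- A (deterministic) algorithm for the fully connected network with node set `V`: finite sets of
states, pulse states, messages and timers, a transition function and a message function.
A message is a tuple of `streams` symbols: a channel carries `streams` message streams in parallel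
(`streams = 1` is the case of one stream of plain messages from the alphabet `Sym`). -/
structure Algorithm (V : Type) where
  /-- the finite, non-empty set of local states -/
  State : Type
  finite_state : Finite State
  nonempty_state : Nonempty State
  /-- a node generates a pulse whenever it transitions to one of these states -/
  pulse : Set State
  /-- number of message streams on each channel -/
  streams : ℕ
  /-- the finite set of symbols that messages are made of -/
  Sym : Type
  finite_sym : Finite Sym
  /-- number of timers of each node -/
  timers : ℕ
  /-- length of each timer, in local time -/
  len : Fin timers → ℝ
  len_nonneg : ∀ k, 0 ≤ len k
  /-- a timer is reset whenever the node transitions to one of these states -/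
  resetOn : Fin timers → Set State
  /-- the transition function: node, current state, most recent message from every node,
  set of expired timers -/
  step : V → State → (V → Fin streams → Sym) → Set (Fin timers) → State
  /-- the message function: sender, receiver, state of the sender -/
  send : V → V → State → Fin streams → Sym

/-- A message: one symbol for each stream. -/
abbrev Algorithm.Msg {V : Type} (A : Algorithm V) : Type := Fin A.streams → A.Sym

/-! ### Executions -/

/-- The data of a run of an algorithm, as functions of reference time `t ≥ 0`. -/
structure Run {V : Type} (A : Algorithm V) where
  /-- state of a node -/
  state : V → ℝ → A.State
  /-- `inbox u t v` is the most recent message that `u` has received from `v` by time `t` -/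
  inbox : V → ℝ → V → A.Msg
  /-- reading of the local clock of a node -/
  clock : V → ℝ → ℝ
  /-- `timer v k t` is the local time left on timer `k` of node `v` at time `t` -/
  timer : V → Fin A.timers → ℝ → ℝ
  /-- `delay u v t` is the time at which `u` receives what `v` sends to `u` at time `t` -/
  delay : V → V → ℝ → ℝ
  /-- the times at which a node evaluates its transition function (it must do so at the events
  listed below, and the adversary may let it do so at further times) -/
  updates : V → Set ℝ

namespace Run

variable {V : Type} {A : Algorithm V}

/-- Node `v` transitions to a state in `S` at time `t`. -/
def TransitionsTo (x : Run A) (v : V) (S : Set A.State) (t : ℝ) : Prop :=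
  ChangesAt (x.state v) t ∧ x.state v t ∈ S

/-- Node `v` resets its timer `k` at time `t`. -/
def Resets (x : Run A) (v : V) (k : Fin A.timers) (t : ℝ) : Prop :=
  x.TransitionsTo v (A.resetOn k) t

/-- Timer `k` of node `v` has run down by time `t`, not taking a reset at time `t` itself into
account: the remaining time at some earlier time `r` after the last reset before `t` has elapsed on
the local clock by time `t`. -/
def Expired (x : Run A) (v : V) (k : Fin A.timers) (t : ℝ) : Prop :=
  ∃ r, 0 ≤ r ∧ r < t ∧ (∀ r' ∈ Ioo r t, ¬ x.Resets v k r') ∧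
    x.timer v k r ≤ x.clock v t - x.clock v r

/-- Timer `k` of node `v` expires at time `t`: it reaches `0` at that very moment. -/
def ExpiresAt (x : Run A) (v : V) (k : Fin A.timers) (t : ℝ) : Prop :=
  0 < t ∧ x.Expired v k t ∧ ∀ᶠ t' in 𝓝[<] t, 0 < x.timer v k t'

/-- `x` is an execution of `A` with maximum message delay `d`, maximum clock drift `ϑ - 1` and set
`F` of faulty nodes. The local configurations at time `0` (states, input channels, clock values,
timers) are arbitrary, and so are all later messages from faulty nodes. -/
structure IsExecution (x : Run A) (d ϑ : ℝ) (F : Finset V) : Prop where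
  clock_nonneg : ∀ v, 0 ≤ x.clock v 0
  clock_drift : ∀ v t t', 0 ≤ t → t < t' →
    t' - t ≤ x.clock v t' - x.clock v t ∧ x.clock v t' - x.clock v t ≤ ϑ * (t' - t)
  delay_mono : ∀ u v, StrictMonoOn (x.delay u v) (Ici 0)
  delay_cont : ∀ u v, ContinuousOn (x.delay u v) (Ici 0)
  delay_bound : ∀ u v t, 0 ≤ t → t < x.delay u v t ∧ x.delay u v t < t + d
  /-- messages of correct nodes arrive after the delay; what the channel holds before the first
  arrival is arbitrary -/
  receive : ∀ u, u ∉ F → ∀ v, v ∉ F → ∀ t, 0 ≤ t →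
    x.inbox u (x.delay u v t) v = A.send v u (x.state v t)
  inbox_signal : ∀ u, u ∉ F → IsSignal (x.inbox u)
  state_signal : ∀ v, v ∉ F → IsSignal (x.state v)
  /-- updates take place at positive times, finitely many in bounded time -/
  updates_pos : ∀ v, v ∉ F → ∀ t ∈ x.updates v, 0 < t
  updates_finite : ∀ v, v ∉ F → ∀ b, (x.updates v ∩ Iic b).Finite
  /-- a node updates its state when its input channels change -/
  update_of_inbox : ∀ v, v ∉ F → ∀ t, ChangesAt (x.inbox v) t → t ∈ x.updates v
  /-- a node updates its state when one of its timers expires -/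
  update_of_timer : ∀ v, v ∉ F → ∀ k t, x.ExpiresAt v k t → t ∈ x.updates v
  /-- every node performs some update within the first time unit (otherwise a system that starts
  with consistent channels and all timers expired would never take a step) -/
  update_start : ∀ v, v ∉ F → (x.updates v ∩ Ioc 0 d).Nonempty
  state_update : ∀ v, v ∉ F → ∀ t ∈ x.updates v, ∀ s, JustBefore (x.state v) t s →
    x.state v t = A.step v s (x.inbox v t) {k | x.Expired v k t}
  state_keep : ∀ v, v ∉ F → ∀ t, 0 < t → t ∉ x.updates v → ¬ ChangesAt (x.state v) t
  timer_init : ∀ v, v ∉ F → ∀ k, x.timer v k 0 ∈ Icc 0 (A.len k)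
  timer_reset : ∀ v, v ∉ F → ∀ k t, x.Resets v k t → x.timer v k t = A.len k
  timer_run : ∀ v, v ∉ F → ∀ k r t, 0 ≤ r → r ≤ t → (∀ r' ∈ Ioc r t, ¬ x.Resets v k r') →
    x.timer v k t = max 0 (x.timer v k r - (x.clock v t - x.clock v r))

/-- The times at which node `v` generates a pulse. -/
def pulses (x : Run A) (v : V) : Set ℝ :=
  {t | x.TransitionsTo v A.pulse t}

/-- The system has stabilised from time `t` on, with skew `σ` and accuracy `(Φm, Φp)`.
Here `p v k` is the time of the pulse number `k` (counted from `0`) of `v` at or after time `t`. -/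
def StabilisedFrom (x : Run A) (F : Finset V) (σ Φm Φp t : ℝ) : Prop :=
  ∃ p : V → ℕ → ℝ,
    (∀ v, v ∉ F → StrictMono (p v) ∧ range (p v) = x.pulses v ∩ Ici t) ∧
    (∀ v, v ∉ F → p v 0 ≤ t + Φp) ∧
    (∀ u, u ∉ F → ∀ v, v ∉ F → ∀ k, |p v k - p u k| < σ) ∧
    (∀ v, v ∉ F → ∀ k, ∃ w, w ∉ F ∧ (∀ u, u ∉ F → p w k ≤ p u k) ∧
      Φm ≤ p v (k + 1) - p w k ∧ p v (k + 1) - p w k ≤ Φp)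

/-- Some time `t` starts a good resynchronisation pulse with skew `ρ` and separation window `Ψ`. -/
def GoodResyncAt (x : Run A) (F : Finset V) (ρ Ψ t : ℝ) : Prop :=
  ∀ v, v ∉ F → ∃ r ∈ x.pulses v, r ∈ Ico t (t + ρ) ∧
    ∀ r' ∈ x.pulses v, r' ∈ Ico t (t + ρ + Ψ) → r' = r

/-- Number of bits that node `u` sends to node `v` during `[a, b)`. A symbol is sent on a stream
whenever the symbol to be transmitted on it changes; if the sender can ever use `N` different
symbols on this stream of this channel, then sending one of them costs `⌈log₂ N⌉` bits. -/
noncomputable def bits (x : Run A) (u v : V) (a b : ℝ) : ℕ∞ :=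
  ∑ c : Fin A.streams, (Nat.clog 2 (range fun s => A.send u v s c).ncard : ℕ∞) *
    {t | t ∈ Ico a b ∧ ChangesAt (fun t => A.send u v (x.state u t) c) t}.encard

end Run

/-! ### Pulse synchronisation, resynchronisation, communication -/

namespace Algorithm

variable {V : Type}

/-- `A` is an `f`-resilient pulse synchronisation algorithm with skew `σ` and accuracy `(Φm, Φp)`
that stabilises within time `τ`. -/
def IsPulseSync (A : Algorithm V) (d ϑ : ℝ) (f : ℕ) (σ Φm Φp τ : ℝ) : Prop :=
  ∀ F : Finset V, F.card ≤ f → ∀ x : Run A, x.IsExecution d ϑ F →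
    ∃ t, 0 ≤ t ∧ t ≤ τ ∧ x.StabilisedFrom F σ Φm Φp t

/-- `A` is an `f`-resilient resynchronisation algorithm with skew `ρ` and separation window `Ψ`
that stabilises within time `τ`. -/
def IsResync (A : Algorithm V) (d ϑ : ℝ) (f : ℕ) (ρ Ψ τ : ℝ) : Prop :=
  ∀ F : Finset V, F.card ≤ f → ∀ x : Run A, x.IsExecution d ϑ F →
    ∃ t, 0 ≤ t ∧ t ≤ τ ∧ x.GoodResyncAt F ρ Ψ t

/-- The maximum number of bits that a correct node sends on a channel per time unit `d`, over all
executions of `A`. -/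
noncomputable def bitRate (A : Algorithm V) (d ϑ : ℝ) : ℕ∞ :=
  sSup {b | ∃ (F : Finset V) (x : Run A) (u v : V) (t : ℝ),
    x.IsExecution d ϑ F ∧ u ∉ F ∧ 0 ≤ t ∧ b = x.bits u v t (t + d)}

end Algorithm

/-- The threshold `φ₀(ϑ)` for the ratio of the accuracy bounds. -/
noncomputable def phiZero (ϑ : ℝ) : ℝ :=
  1 + 5 * (ϑ - 1) / (2 + 2 * ϑ - 3 * ϑ ^ 2)

/-! ### Signals -/

/-! The two blocks run pulse synchronisation with periods of about `S` and `3S/2`. As `f ≤ f₀ + f₁ +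
1`, one block has no more faults than it tolerates and eventually pulses regularly. The other block
may be entirely under the control of the adversary, and has to be made harmless.

All nodes vote on the pulses of each block. Pulses and votes are announced by beacons, whose phases
last more than `5 * d` and are therefore seen by everybody. If a correct node sees `n - f` votes in
phase 1, more than `f` of them come from correct nodes and are still non-zero one delay later, so
every correct node notices an event (`IsVoting.support_of_accept`). A node triggers only during an
event whose distance from the previous one is between `lo` and `hi`, slightly less and slightly more
than the range of periods of the block, and only if no irregular event occurred recently. Hence,
whatever the faulty nodes do, two triggers of correct nodes on the same block that are not close
together are at least about `lo` apart, and their distance is either at most about `hi` or at least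
about `2 * lo` (`IsVoting.trigger_distance`).

A block that works makes every correct node trigger exactly once in each of its pulse windows, from
index 4 on (`IsPulsing.exists_unique_trigger`). If the other block spoilt both windows 4 and 5, two
of its triggers would be about one period of the working block apart. But `S` is less than `lo ≈
3S/2`, and `3S/2` lies strictly between `hi ≈ S` and `2 * lo ≈ 2S`. So one of the two windows is
good (`Resync.exists_goodResyncAt`, `Resync.isResync`).

To speak about the blocks, each run of the combined algorithm is restricted to a run of the inner
one (`Run.IsExecution.restrict`). The beacons of a node have 27 joint phases and change at most
three times per time unit, which costs 15 bits on one additional stream (`Resync.bitRate_le`). -/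

theorem JustBefore.unique {α : Type} {g : ℝ → α} {t : ℝ} {a b : α} (ha : JustBefore g t a)
    (hb : JustBefore g t b) : a = b := by
  obtain ⟨s, hs, hs'⟩ := (Filter.Eventually.and ha hb).exists
  exact hs.symm.trans hs'

theorem JustBefore.comp {α β : Type} {g : ℝ → α} {t : ℝ} {a : α} (h : JustBefore g t a)
    (φ : α → β) : JustBefore (fun t => φ (g t)) t (φ a) := by
  filter_upwards [h] with s hs
  rw [hs]

theorem IsSignal.comp {α β : Type} {g : ℝ → α} (h : IsSignal g) (φ : α → β) :
    IsSignal fun t => φ (g t) := by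
  refine ⟨fun t ht => ?_, fun t ht => ?_⟩
  · filter_upwards [h.1 t ht] with s hs
    rw [hs]
  · obtain ⟨a, ha⟩ := h.2 t ht
    exact ⟨φ a, ha.comp φ⟩

theorem ChangesAt.of_comp {α β : Type} {g : ℝ → α} {φ : α → β} {t : ℝ}
    (h : ChangesAt (fun t => φ (g t)) t) : ChangesAt g t :=
  ⟨h.1, fun hb => h.2 (hb.comp φ)⟩

theorem ChangesAt.comp_injective {α β : Type} {g : ℝ → α} {φ : α → β} (hφ : φ.Injective) {t : ℝ} :
    ChangesAt (fun t => φ (g t)) t ↔ ChangesAt g t := by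
  refine ⟨ChangesAt.of_comp, fun h => ⟨h.1, fun hb => h.2 ?_⟩⟩
  filter_upwards [hb] with s hs
  exact hφ hs

theorem not_changesAt_const {α : Type} (a : α) (t : ℝ) : ¬ ChangesAt (fun _ => a) t :=
  fun h => h.2 (Eventually.of_forall fun _ => rfl)

/-- Continuous induction along `[r, t]`: without changes the set of times with value `g r` is
closed, and right-continuity extends it to the right. -/
theorem IsSignal.eq_of_forall_not_changesAt {α : Type} {g : ℝ → α} (hg : IsSignal g) {r t : ℝ}
    (hr : 0 ≤ r) (hrt : r ≤ t) (h : ∀ s ∈ Ioc r t, ¬ ChangesAt g s) : g t = g r := by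
  have hcl : IsClosed ({x | g x = g r} ∩ Icc r t) := by
    refine isClosed_of_closure_subset fun x hx => ?_
    have hxI : x ∈ Icc r t := by
      have := closure_mono (inter_subset_right (s := {x | g x = g r})) hx
      rwa [isClosed_Icc.closure_eq] at this
    refine ⟨?_, hxI⟩
    -- The left endpoint is treated separately because a change at `r` itself is allowed.
    rcases hxI.1.eq_or_lt with rfl | hlt
    · rfl
    have hx0 : 0 < x := hr.trans_lt hlt
    have hl : JustBefore g x (g x) := by
      by_contra hc
      exact h x ⟨hlt, hxI.2⟩ ⟨hx0, hc⟩
    have hn : ∀ᶠ y in 𝓝[≠] x, g y = g x := by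
      rw [← Iio_union_Ioi, nhdsWithin_union]
      exact eventually_sup.2 ⟨hl, hg.1 x hx0.le⟩
    have hn' : ∀ᶠ y in 𝓝 x, g y = g x := by
      rw [eventually_nhdsWithin_iff] at hn
      filter_upwards [hn] with y hy
      by_cases hyx : y = x
      · rw [hyx]
      · exact hy hyx
    obtain ⟨y, hy, hy'⟩ := ((mem_closure_iff_frequently.1 hx).and_eventually hn').exists
    exact hy'.symm.trans hy.1
  have := hcl.Icc_subset_of_forall_mem_nhdsWithin (by simp) (fun x hx => by
    have := hg.1 x (hr.trans hx.2.1)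
    filter_upwards [this] with y hy
    exact hy.trans hx.1)
  exact this ⟨hrt, le_rfl⟩

/-! ### Update schedules -/

/-- A locally finite set of positive times that meets `(0, d]`. -/
structure IsSchedule (U : Set ℝ) (d : ℝ) : Prop where
  pos : ∀ u ∈ U, 0 < u
  finite : ∀ b, (U ∩ Iic b).Finite
  start : (U ∩ Ioc 0 d).Nonempty

/-- No element of `U` lies strictly between `r` and `t`. -/
structure Gap (U : Set ℝ) (r t : ℝ) : Prop where
  nonneg : 0 ≤ r
  lt : r < t
  notMem : ∀ u ∈ U, u ∉ Ioo r t

theorem exists_last_of_finite {R : Set ℝ} {a b : ℝ} (hR : (R ∩ Iic b).Finite) {c : ℝ} (hc : c ∈ R)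
    (hac : a ≤ c) (hcb : c ≤ b) : ∃ e ∈ R, a ≤ e ∧ e ≤ b ∧ ∀ r ∈ R, r ∉ Ioc e b := by
  have hfin : (R ∩ Icc a b).Finite := hR.subset fun x hx => ⟨hx.1, hx.2.2⟩
  obtain ⟨e, he, hmax⟩ := exists_max_image _ id hfin ⟨c, hc, hac, hcb⟩
  refine ⟨e, he.1, he.2.1, he.2.2, fun r hr hrI => ?_⟩
  have := hmax r ⟨hr, he.2.1.trans hrI.1.le, hrI.2⟩
  exact absurd hrI.1 (not_lt.2 this)

theorem exists_first_of_finite {R : Set ℝ} {a b : ℝ} (hR : (R ∩ Iic b).Finite) {c : ℝ} (hc : c ∈ R)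
    (hac : a ≤ c) (hcb : c ≤ b) : ∃ e ∈ R, a ≤ e ∧ e ≤ b ∧ ∀ r ∈ R, r ∉ Ico a e := by
  have hfin : (R ∩ Icc a b).Finite := hR.subset fun x hx => ⟨hx.1, hx.2.2⟩
  obtain ⟨e, he, hmin⟩ := exists_min_image _ id hfin ⟨c, hc, hac, hcb⟩
  refine ⟨e, he.1, he.2.1, he.2.2, fun r hr hrI => ?_⟩
  have := hmin r ⟨hr, hrI.1, hrI.2.le.trans he.2.2⟩
  exact absurd hrI.2 (not_lt.2 this)

namespace IsSchedule

variable {U : Set ℝ} {d : ℝ}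

/-- The gap begins at the last update in `[a, u)`, or at `a` if there is none. So the state just
before `u` is always the state at some definite time not before `a`. -/
theorem exists_gap (h : IsSchedule U d) {a u : ℝ} (ha : 0 ≤ a) (hau : a < u) :
    ∃ r, a ≤ r ∧ Gap U r u := by
  by_cases hne : ∃ c ∈ U, a ≤ c ∧ c < u
  · obtain ⟨c, hc, hac, hcu⟩ := hne
    have hfin : (U ∩ Ico a u).Finite := (h.finite u).subset fun x hx => ⟨hx.1, hx.2.2.le⟩
    obtain ⟨e, he, hmax⟩ := exists_max_image _ id hfin ⟨c, hc, hac, hcu⟩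
    refine ⟨e, he.2.1, ha.trans he.2.1, he.2.2, fun r hr hrI => ?_⟩
    have := hmax r ⟨hr, he.2.1.trans hrI.1.le, hrI.2⟩
    exact absurd hrI.1 (not_lt.2 this)
  · push Not at hne
    exact ⟨a, le_rfl, ha, hau, fun r hr hrI => absurd hrI.2 (not_lt.2 (hne r hr hrI.1.le))⟩

theorem exists_last (h : IsSchedule U d) {t : ℝ} (ht : d ≤ t) :
    ∃ u ∈ U, u ≤ t ∧ ∀ s ∈ U, s ∉ Ioc u t := by
  obtain ⟨c, hc, hc'⟩ := h.start
  obtain ⟨e, he, -, het, hl⟩ := exists_last_of_finite (h.finite t) hc hc'.1.le (hc'.2.trans ht)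
  exact ⟨e, he, het, hl⟩

/-- Induction on the number of updates in `Ioc a c`: an invariant has to be checked only across
stretches without updates and across single updates. -/
theorem induction (h : IsSchedule U d) {Q : ℝ → Prop} {a b : ℝ} (ha : 0 ≤ a) (hab : a ≤ b)
    (h0 : Q a)
    (keep : ∀ r t, a ≤ r → r ≤ t → t ≤ b → (∀ u ∈ U, u ∉ Ioc r t) → Q r → Q t)
    (step : ∀ r u, u ∈ U → a ≤ r → Gap U r u → u ≤ b → Q r → Q u) : Q b := by
  suffices H : ∀ N : ℕ, ∀ c, a ≤ c → c ≤ b → (U ∩ Ioc a c).ncard = N → Q c from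
    H _ b hab le_rfl rfl
  intro N
  induction N using Nat.strong_induction_on with
  | _ N ih =>
    intro c hac hcb hN
    have hfin : ∀ c, (U ∩ Ioc a c).Finite := fun c =>
      (h.finite c).subset fun x hx => ⟨hx.1, hx.2.2⟩
    by_cases hne : ∃ u ∈ U, a < u ∧ u ≤ c
    · obtain ⟨u₁, hu₁, hau₁, hu₁c⟩ := hne
      obtain ⟨u, hu, hau, huc, hlast⟩ := exists_last_of_finite (h.finite c) hu₁ hau₁.le hu₁c
      have hau' : a < u := by
        by_contra hc
        exact hlast u₁ hu₁ ⟨(not_lt.1 hc).trans_lt hau₁, hu₁c⟩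
      obtain ⟨r, har, hgap⟩ := h.exists_gap ha hau'
      have hlt : (U ∩ Ioc a r).ncard < N := by
        rw [← hN]
        refine ncard_lt_ncard ⟨fun x hx => ⟨hx.1, hx.2.1, hx.2.2.trans (hgap.lt.le.trans huc)⟩,
          fun hsub => ?_⟩ (hfin c)
        exact absurd (hsub ⟨hu, hau', huc⟩).2.2 (not_le.2 hgap.lt)
      have hQr := ih _ hlt r har (hgap.lt.le.trans (huc.trans hcb)) rfl
      exact keep u c hau huc hcb hlast (step r u hu har hgap (huc.trans hcb) hQr)
    · push Not at hne
      exact keep a c le_rfl hac hcb (fun u hu huI => absurd huI.2 (not_le.2 (hne u hu huI.1))) h0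

end IsSchedule

/-! ### Traces, levels, clocks and timers of a single node -/

/-- `g` changes at the times in `U` only, where its new value is obtained from the previous one by
applying `next`. -/
structure IsTrace {α : Type} (U : Set ℝ) (g : ℝ → α) (next : ℝ → α → α) : Prop where
  keep : ∀ r t, 0 ≤ r → r ≤ t → (∀ u ∈ U, u ∉ Ioc r t) → g t = g r
  step : ∀ r u, u ∈ U → Gap U r u → g u = next u (g r)

/-- A property that changes at the times in `U` only. -/
def IsLevel (U : Set ℝ) (L : Set ℝ) : Prop :=
  ∀ r t, 0 ≤ r → r ≤ t → (∀ u ∈ U, u ∉ Ioc r t) → (t ∈ L ↔ r ∈ L)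

/-- A clock with rate between `1` and `1.004`. -/
def IsClock (C : ℝ → ℝ) : Prop :=
  ∀ t t', 0 ≤ t → t ≤ t' → t' - t ≤ C t' - C t ∧ C t' - C t ≤ 1.004 * (t' - t)

/-- A timer of length `ℓ` on the clock `C` that is reset at the times in `R` and has run down at the
times in `X`. -/
structure IsTimer (U : Set ℝ) (C : ℝ → ℝ) (d ℓ : ℝ) (R X : Set ℝ) : Prop where
  expired_of : ∀ a t, 0 ≤ a → a < t → (∀ r ∈ R, r ∉ Ioo a t) → ℓ ≤ C t - C a → t ∈ X
  le_of_expired : ∀ a t, a ∈ R → a < t → t ∈ X → ℓ ≤ C t - C a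
  expired_mono : ∀ a t, a ∈ X → 0 ≤ a → a ≤ t → (∀ r ∈ R, r ∉ Ico a t) → t ∈ X
  fires : ∀ a, a = 0 ∨ a ∈ R → ∃ u ∈ U, a < u ∧ u ≤ a + ℓ + d ∧ (u ∈ X ∨ u ∈ R)

/-- Clocks are Lipschitz, hence continuous. The exact moment is needed because a node is only forced
to update at the very moment when a timer reaches zero. -/
theorem IsClock.exists_add_eq {C : ℝ → ℝ} (hC : IsClock C) {a τ : ℝ} (ha : 0 ≤ a) (hτ : 0 < τ) :
    ∃ b, a < b ∧ b ≤ a + τ ∧ C b - C a = τ := by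
  have hcont : ContinuousOn C (Icc a (a + τ)) := by
    have : LipschitzOnWith 2 C (Icc a (a + τ)) := by
      refine LipschitzOnWith.of_le_add_mul _ fun x hx y hy => ?_
      rw [Real.dist_eq]
      rcases le_total x y with hxy | hxy
      · have := (hC x y (ha.trans hx.1) hxy).1
        have h2 := abs_nonneg (x - y)
        push_cast
        linarith
      · have := (hC y x (ha.trans hy.1) hxy).2
        rw [abs_of_nonneg (sub_nonneg.2 hxy)]
        push_cast
        linarith
    exact this.continuousOn
  have h1 := (hC a (a + τ) ha (by linarith)).1
  obtain ⟨b, hb, hb'⟩ := intermediate_value_Icc (by linarith : a ≤ a + τ) hcont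
    (show C a + τ ∈ Icc (C a) (C (a + τ)) from ⟨by linarith, by linarith⟩)
  refine ⟨b, lt_of_le_of_ne hb.1 ?_, hb.2, by linarith⟩
  rintro rfl
  linarith

/-! ### Nodes of an execution -/

namespace Run.IsExecution

variable {V : Type} {A : Algorithm V} {x : Run A} {d ϑ : ℝ} {F : Finset V} {v : V}

theorem isSchedule (hx : x.IsExecution d ϑ F) (hv : v ∉ F) : IsSchedule (x.updates v) d :=
  ⟨hx.updates_pos v hv, hx.updates_finite v hv, hx.update_start v hv⟩

theorem isClock (hx : x.IsExecution d ϑ F) (hϑ : ϑ ≤ 1.004) (v : V) : IsClock (x.clock v) := by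
  intro t t' ht htt'
  rcases htt'.eq_or_lt with rfl | hlt
  · simp
  · obtain ⟨h1, h2⟩ := hx.clock_drift v t t' ht hlt
    exact ⟨h1, h2.trans (mul_le_mul_of_nonneg_right hϑ (by linarith))⟩

theorem isTrace (hx : x.IsExecution d ϑ F) (hv : v ∉ F) :
    IsTrace (x.updates v) (x.state v)
      fun u s => A.step v s (x.inbox v u) {k | x.Expired v k u} := by
  have keep : ∀ r t, 0 ≤ r → r ≤ t → (∀ u ∈ x.updates v, u ∉ Ioc r t) →
      x.state v t = x.state v r := fun r t hr hrt hno =>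
    (hx.state_signal v hv).eq_of_forall_not_changesAt hr hrt fun s hs =>
      hx.state_keep v hv s (hr.trans_lt hs.1) fun hsU => hno s hsU hs
  refine ⟨keep, fun r u hu hgap => hx.state_update v hv u hu _ ?_⟩
  filter_upwards [Ioo_mem_nhdsLT hgap.lt] with s hs
  exact keep r s hgap.nonneg hs.1.le fun w hw hwI => hgap.notMem w hw ⟨hwI.1, hwI.2.trans_lt hs.2⟩

theorem justBefore_of_gap (hx : x.IsExecution d ϑ F) (hv : v ∉ F) {r u : ℝ}
    (hgap : Gap (x.updates v) r u) : JustBefore (x.state v) u (x.state v r) := by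
  filter_upwards [Ioo_mem_nhdsLT hgap.lt] with s hs
  exact (hx.isTrace hv).keep r s hgap.nonneg hs.1.le
    fun w hw hwI => hgap.notMem w hw ⟨hwI.1, hwI.2.trans_lt hs.2⟩

theorem inbox_keep (hx : x.IsExecution d ϑ F) (hv : v ∉ F) (r t : ℝ) (hr : 0 ≤ r) (hrt : r ≤ t)
    (hno : ∀ u ∈ x.updates v, u ∉ Ioc r t) : x.inbox v t = x.inbox v r :=
  (hx.inbox_signal v hv).eq_of_forall_not_changesAt hr hrt fun s hs hch =>
    hno s (hx.update_of_inbox v hv s hch) hs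

theorem mem_updates_of_changesAt (hx : x.IsExecution d ϑ F) (hv : v ∉ F) {t : ℝ}
    (h : ChangesAt (x.state v) t) : t ∈ x.updates v := by
  by_contra hc
  exact hx.state_keep v hv t h.1 hc h

/-- What is sent at time `0` arrives before `d`, so by continuity of the delay every later time is
the arrival time of something. -/
theorem exists_received (hx : x.IsExecution d ϑ F) {u : V} (hu : u ∉ F) (hv : v ∉ F) {t : ℝ}
    (ht : d ≤ t) (ht0 : 0 ≤ t) : ∃ s, 0 ≤ s ∧ t - d < s ∧ s < t ∧
      x.inbox u t v = A.send v u (x.state v s) := by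
  have h0 := hx.delay_bound u v 0 le_rfl
  have ht' := hx.delay_bound u v t ht0
  obtain ⟨s, hs, hst⟩ := intermediate_value_Icc ht0
    ((hx.delay_cont u v).mono fun y hy => hy.1)
    (show t ∈ Icc (x.delay u v 0) (x.delay u v t) from ⟨by linarith, ht'.1.le⟩)
  have hb := hx.delay_bound u v s hs.1
  rw [hst] at hb
  refine ⟨s, hs.1, by linarith, hb.1, ?_⟩
  rw [← hx.receive u hu v hv s hs.1, hst]

theorem resets_subset (hx : x.IsExecution d ϑ F) (hv : v ∉ F) (k : Fin A.timers) :
    {t | x.Resets v k t} ⊆ x.updates v :=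
  fun _ ht => hx.mem_updates_of_changesAt hv ht.1

theorem timer_mem (hx : x.IsExecution d ϑ F) (hC : IsClock (x.clock v)) (hv : v ∉ F)
    (k : Fin A.timers) {a : ℝ} (ha : 0 ≤ a) : x.timer v k a ∈ Icc 0 (A.len k) := by
  by_cases h : ∃ c ∈ {t | x.Resets v k t}, 0 ≤ c ∧ c ≤ a
  · obtain ⟨c, hc, hc0, hca⟩ := h
    obtain ⟨e, he, he0, hea, hl⟩ := exists_last_of_finite
      ((hx.updates_finite v hv a).subset (inter_subset_inter_left _ (hx.resets_subset hv k)))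
      hc hc0 hca
    rw [hx.timer_run v hv k e a he0 hea fun r' hr' hR => hl r' hR hr', hx.timer_reset v hv k e he]
    have := (hC e a he0 hea).1
    exact ⟨le_max_left _ _, max_le (A.len_nonneg k) (by linarith)⟩
  · push Not at h
    have h0 := hx.timer_init v hv k
    rw [hx.timer_run v hv k 0 a le_rfl ha fun r' hr' hR =>
      absurd hr'.2 (not_le.2 (h r' hR hr'.1.le))]
    have := (hC 0 a le_rfl ha).1
    exact ⟨le_max_left _ _, max_le (A.len_nonneg k) (by linarith [h0.2])⟩

/-- The extra `d` in `fires` is due to timers that are already at zero at time `0`: they do not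
expire, and only the compulsory update during `(0, d]` takes notice of them. -/
theorem isTimer (hx : x.IsExecution d ϑ F) (hC : IsClock (x.clock v)) (hv : v ∉ F)
    (k : Fin A.timers) (hk : 0 < A.len k) (hd : 0 < d) :
    IsTimer (x.updates v) (x.clock v) d (A.len k) {t | x.Resets v k t} {t | x.Expired v k t} := by
  refine ⟨fun a t ha hat hno hle => ?_, fun a t haR hat hE => ?_, fun a t hE ha hat hno => ?_,
    fun a ha => ?_⟩
  · exact ⟨a, ha, hat, fun r' hr' hR => hno r' hR hr', (hx.timer_mem hC hv k ha).2.trans hle⟩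
  · obtain ⟨r, hr0, hrt, hno, hle⟩ := hE
    have har : a ≤ r := by
      by_contra hc
      exact hno a ⟨not_le.1 hc, hat⟩ haR
    obtain ⟨e, he, hae, her, hl⟩ := exists_last_of_finite
      ((hx.updates_finite v hv r).subset (inter_subset_inter_left _ (hx.resets_subset hv k)))
      haR le_rfl har
    have ha0 : 0 < a := haR.1.1
    have h1 := hx.timer_run v hv k e r (ha0.le.trans hae) her fun r' hr' hR => hl r' hR hr'
    rw [hx.timer_reset v hv k e he] at h1
    have h2 := le_max_right 0 (A.len k - (x.clock v r - x.clock v e))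
    have h3 := (hC a e ha0.le hae).1
    linarith
  · obtain ⟨r, hr0, hra, hno', hle⟩ := hE
    refine ⟨r, hr0, hra.trans_le hat, fun r' hr' hR => ?_,
      hle.trans (by linarith [(hC a t ha hat).1])⟩
    rcases lt_or_ge r' a with h | h
    · exact hno' r' ⟨hr'.1, h⟩ hR
    · exact hno r' hR ⟨h, hr'.2⟩
  · have ha0 : 0 ≤ a := by
      rcases ha with rfl | ha
      · exact le_rfl
      · exact ha.1.1.le
    by_cases hR : ∃ u, x.Resets v k u ∧ u ∈ Ioc a (a + A.len k + d)
    · obtain ⟨u, hu, huI⟩ := hR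
      exact ⟨u, hx.resets_subset hv k hu, huI.1, huI.2, Or.inr hu⟩
    push Not at hR
    have hτ := hx.timer_mem hC hv k ha0
    rcases hτ.1.eq_or_lt with hτ0 | hτ0
    · rcases ha with rfl | ha
      · obtain ⟨u, hu, huI⟩ := hx.update_start v hv
        refine ⟨u, hu, huI.1, by linarith [huI.2], Or.inl ⟨0, le_rfl, huI.1, fun r' hr' hr => ?_, ?_⟩⟩
        · exact hR r' hr ⟨hr'.1, by linarith [hr'.2, huI.2]⟩
        · rw [← hτ0]
          linarith [(hC 0 u le_rfl huI.1.le).1, huI.1]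
      · rw [hx.timer_reset v hv k a ha] at hτ0
        exact absurd hτ0 hk.ne
    · obtain ⟨b, hab, hb, hCb⟩ := hC.exists_add_eq ha0 hτ0
      have hexp : x.Expired v k b :=
        ⟨a, ha0, hab, fun r' hr' hr => hR r' hr ⟨hr'.1, by linarith [hr'.2, hτ.2]⟩, hCb.ge⟩
      refine ⟨b, hx.update_of_timer v hv k b ⟨ha0.trans_lt hab, hexp, ?_⟩, hab,
        by linarith [hτ.2], Or.inl hexp⟩
      filter_upwards [Ioo_mem_nhdsLT hab] with s hs
      rw [hx.timer_run v hv k a s ha0 hs.1.le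
        fun r' hr' hr => hR r' hr ⟨hr'.1, by linarith [hr'.2, hτ.2, hs.2]⟩]
      have := (hC s b (ha0.trans hs.1.le) hs.2.le).1
      exact lt_max_of_lt_right (by linarith [hs.2])

end Run.IsExecution

/-! ### Running an algorithm inside another one -/

/-- The nodes in the range of `ι` run the algorithm `A` as a part of the algorithm `B`. -/
structure Simulation {W V : Type} (A : Algorithm W) (B : Algorithm V) where
  ι : W → V
  proj : B.State → A.State
  timer : Fin A.timers → Fin B.timers
  /-- receiver, sender, message -/
  decode : W → W → B.Msg → A.Msg
  len_timer : ∀ k, B.len (timer k) = A.len k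
  decode_send : ∀ u v s, decode u v (B.send (ι v) (ι u) s) = A.send v u (proj s)
  proj_step : ∀ v s m X, proj (B.step (ι v) s m X) =
    A.step v (proj s) (fun w => decode v w (m (ι w))) {k | timer k ∈ X}
  step_mem_resetOn : ∀ v s m X k, B.step (ι v) s m X ∈ B.resetOn (timer k) ↔
    proj (B.step (ι v) s m X) ≠ proj s ∧ proj (B.step (ι v) s m X) ∈ A.resetOn k
  step_ne : ∀ v s m X, B.step v s m X ≠ s

namespace Run

variable {W V : Type} {A : Algorithm W} {B : Algorithm V} {d ϑ : ℝ} {F : Finset V} {v : V}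

/-- Resets and pulses are tied to changes of state. If no step fixes a state, they can be commanded
at any update by marks in the new state. -/
theorem IsExecution.changesAt_iff_of_step_ne {x : Run B} (hx : x.IsExecution d ϑ F) (hv : v ∉ F)
    (hB : ∀ s m X, B.step v s m X ≠ s) {t : ℝ} :
    ChangesAt (x.state v) t ↔ t ∈ x.updates v := by
  refine ⟨hx.mem_updates_of_changesAt hv, fun ht => ?_⟩
  have ht0 := hx.updates_pos v hv t ht
  refine ⟨ht0, fun hb => ?_⟩
  obtain ⟨r, -, hgap⟩ := (hx.isSchedule hv).exists_gap le_rfl ht0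
  have h1 := (hx.justBefore_of_gap hv hgap).unique hb
  have h2 := (hx.isTrace hv).step r t ht hgap
  rw [← h1] at h2
  exact hB _ _ _ h2.symm

/-- The run of `A` that takes place inside a run of `B`. -/
def restrict (x : Run B) (S : Simulation A B) : Run A where
  state w t := S.proj (x.state (S.ι w) t)
  inbox u t w := S.decode u w (x.inbox (S.ι u) t (S.ι w))
  clock w := x.clock (S.ι w)
  timer w k := x.timer (S.ι w) (S.timer k)
  delay u w := x.delay (S.ι u) (S.ι w)
  updates w := x.updates (S.ι w)

theorem IsExecution.transitionsTo_restrict {x : Run B} (S : Simulation A B)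
    (hx : x.IsExecution d ϑ F) {w : W} (hw : S.ι w ∉ F) {Q : Set A.State} {r t : ℝ}
    (hgap : Gap (x.updates (S.ι w)) r t) :
    (x.restrict S).TransitionsTo w Q t ↔
      S.proj (x.state (S.ι w) t) ≠ S.proj (x.state (S.ι w) r) ∧ S.proj (x.state (S.ι w) t) ∈ Q := by
  refine and_congr_left fun _ => ⟨fun h he => h.2 ?_, fun h =>
    ⟨hgap.nonneg.trans_lt hgap.lt, fun hb => h ?_⟩⟩
  · have := (hx.justBefore_of_gap hw hgap).comp S.proj
    rwa [← he] at this
  · exact hb.unique ((hx.justBefore_of_gap hw hgap).comp S.proj)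

/-- Both kinds of reset happen at updates only. There the outer state always changes, but the copied
timer is reset only if the inner state changes as well. -/
theorem IsExecution.resets_restrict {x : Run B} (S : Simulation A B)
    (hx : x.IsExecution d ϑ F) {w : W} (hw : S.ι w ∉ F) (k : Fin A.timers) (t : ℝ) :
    (x.restrict S).Resets w k t ↔ x.Resets (S.ι w) (S.timer k) t := by
  by_cases ht : t ∈ x.updates (S.ι w)
  · obtain ⟨r, -, hgap⟩ := (hx.isSchedule hw).exists_gap le_rfl (hx.updates_pos _ hw t ht)
    have h2 := (hx.isTrace hw).step r t ht hgap
    unfold Resets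
    rw [hx.transitionsTo_restrict S hw hgap]
    unfold TransitionsTo
    rw [hx.changesAt_iff_of_step_ne hw (S.step_ne _), h2, ← S.step_mem_resetOn]
    exact ⟨fun h => ⟨ht, h⟩, fun h => h.2⟩
  · exact ⟨fun h => absurd (hx.mem_updates_of_changesAt hw (ChangesAt.of_comp (φ := S.proj) h.1)) ht,
      fun h => absurd (hx.mem_updates_of_changesAt hw h.1) ht⟩

theorem IsExecution.expired_restrict {x : Run B} (S : Simulation A B)
    (hx : x.IsExecution d ϑ F) {w : W} (hw : S.ι w ∉ F) (k : Fin A.timers) (t : ℝ) :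
    (x.restrict S).Expired w k t ↔ x.Expired (S.ι w) (S.timer k) t := by
  unfold Expired
  simp only [hx.resets_restrict S hw]
  rfl

/-- Other timers and other parts of the messages cause updates that the inner algorithm alone would
not make. They count as further updates chosen by the adversary. -/
theorem IsExecution.restrict {x : Run B} (S : Simulation A B) (hx : x.IsExecution d ϑ F)
    {F' : Finset W} (hF : ∀ w, w ∈ F' ↔ S.ι w ∈ F) : (x.restrict S).IsExecution d ϑ F' where
  clock_nonneg w := hx.clock_nonneg _
  clock_drift w := hx.clock_drift _
  delay_mono u w := hx.delay_mono _ _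
  delay_cont u w := hx.delay_cont _ _
  delay_bound u w := hx.delay_bound _ _
  receive u hu w hw t ht := by
    have := hx.receive (S.ι u) (mt (hF u).2 hu) (S.ι w) (mt (hF w).2 hw) t ht
    change S.decode u w (x.inbox (S.ι u) (x.delay (S.ι u) (S.ι w) t) (S.ι w)) = _
    rw [this]
    exact S.decode_send u w _
  inbox_signal u hu :=
    (hx.inbox_signal (S.ι u) (mt (hF u).2 hu)).comp fun m w => S.decode u w (m (S.ι w))
  state_signal w hw := (hx.state_signal _ (mt (hF w).2 hw)).comp S.proj
  updates_pos w hw := hx.updates_pos _ (mt (hF w).2 hw)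
  updates_finite w hw := hx.updates_finite _ (mt (hF w).2 hw)
  update_of_inbox w hw t ht :=
    hx.update_of_inbox _ (mt (hF w).2 hw) t
      (ChangesAt.of_comp (g := x.inbox (S.ι w)) (φ := fun m w' => S.decode w w' (m (S.ι w'))) ht)
  update_of_timer w hw k t ht :=
    hx.update_of_timer _ (mt (hF w).2 hw) (S.timer k) t
      ⟨ht.1, (hx.expired_restrict S (mt (hF w).2 hw) k t).1 ht.2.1, ht.2.2⟩
  update_start w hw := hx.update_start _ (mt (hF w).2 hw)
  state_update w hw t ht s hs := by
    have hw' := mt (hF w).2 hw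
    obtain ⟨r, -, hgap⟩ := (hx.isSchedule hw').exists_gap le_rfl (hx.updates_pos _ hw' t ht)
    have h1 := hs.unique ((hx.justBefore_of_gap hw' hgap).comp S.proj)
    have h2 := (hx.isTrace hw').step r t ht hgap
    change S.proj (x.state (S.ι w) t) = _
    rw [h2, S.proj_step, h1]
    congr 1
    ext k
    exact (hx.expired_restrict S hw' k t).symm
  state_keep w hw t ht0 ht h := hx.state_keep _ (mt (hF w).2 hw) t ht0 ht (ChangesAt.of_comp (φ := S.proj) h)
  timer_init w hw k := by
    rw [← S.len_timer]
    exact hx.timer_init _ (mt (hF w).2 hw) _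
  timer_reset w hw k t ht := by
    rw [← S.len_timer]
    exact hx.timer_reset _ (mt (hF w).2 hw) _ t ((hx.resets_restrict S (mt (hF w).2 hw) k t).1 ht)
  timer_run w hw k r t hr hrt hno :=
    hx.timer_run _ (mt (hF w).2 hw) _ r t hr hrt fun r' hr' h =>
      hno r' hr' ((hx.resets_restrict S (mt (hF w).2 hw) k r').2 h)

end Run

/-! ### Beacons: state machines cycling through `0` (off), `1` (on), `2` (fading) -/

open Classical in
/-- A beacon advances whenever its timer has expired, but leaves phase `0` only if it is triggered
by its input. -/
noncomputable def beaconStep (p : Fin 3) (inp expired : Prop) : Fin 3 :=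
  if expired ∧ (p = 0 → inp) then p + 1 else p

/-- The input matters at updates only, so `inp` can be a momentary event (a pulse) as well as a
lasting condition (enough announcements seen). -/
structure IsBeacon (U : Set ℝ) (C : ℝ → ℝ) (d : ℝ) (ph : ℝ → Fin 3) (inp R X : Set ℝ) : Prop where
  schedule : IsSchedule U d
  clock : IsClock C
  timer : IsTimer U C d (6 * d) R X
  trace : IsTrace U ph fun u p => beaconStep p (u ∈ inp) (u ∈ X)
  mem_reset : ∀ r u, u ∈ U → Gap U r u → (u ∈ R ↔ ph u ≠ ph r)
  reset_subset : R ⊆ U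

namespace IsBeacon

variable {U : Set ℝ} {C : ℝ → ℝ} {d : ℝ} {ph : ℝ → Fin 3} {inp R X : Set ℝ}

theorem advance (h : IsBeacon U C d ph inp R X) {r u : ℝ} (hu : u ∈ U) (hg : Gap U r u)
    (hX : u ∈ X) (hi : ph r = 0 → u ∈ inp) : ph u = ph r + 1 ∧ u ∈ R := by
  have h1 := h.trace.step r u hu hg
  simp only [beaconStep] at h1
  rw [if_pos ⟨hX, hi⟩] at h1
  refine ⟨h1, (h.mem_reset r u hu hg).2 ?_⟩
  rw [h1]
  generalize ph r = p
  revert p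
  decide

theorem of_mem_reset (h : IsBeacon U C d ph inp R X) {r u : ℝ} (hu : u ∈ R) (hg : Gap U r u) :
    u ∈ X ∧ (ph r = 0 → u ∈ inp) ∧ ph u = ph r + 1 := by
  have h1 := h.trace.step r u (h.reset_subset hu) hg
  have h2 := (h.mem_reset r u (h.reset_subset hu) hg).1 hu
  simp only [beaconStep] at h1
  split_ifs at h1 with hc
  · exact ⟨hc.1, hc.2, h1⟩
  · exact absurd h1 h2

theorem eq_of_no_reset (h : IsBeacon U C d ph inp R X) {a b : ℝ} (ha : 0 ≤ a) (hab : a ≤ b)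
    (hno : ∀ r ∈ R, r ∉ Ioc a b) : ph b = ph a := by
  refine h.schedule.induction (Q := fun t => ph t = ph a) ha hab rfl
    (fun r t har hrt _ hU hr => (h.trace.keep r t (ha.trans har) hrt hU).trans hr)
    fun r u hu har hg hub hr => ?_
  by_contra hc
  exact hno u ((h.mem_reset r u hu hg).2 fun he => hc (he.trans hr)) ⟨har.trans_lt hg.lt, hub⟩

theorem pos_of_mem_reset (h : IsBeacon U C d ph inp R X) {a : ℝ} (ha : a ∈ R) : 0 < a :=
  h.schedule.pos a (h.reset_subset ha)

/-- A phase is left only after local time `6 * d`, and `6 / 1.004 > 5`. This bounds both the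
visibility of a phase and the number of messages. -/
theorem reset_separated (h : IsBeacon U C d ph inp R X) (hd : 0 < d) {a b : ℝ} (ha : a ∈ R)
    (hb : b ∈ R) (hab : a < b) : a + 5 * d < b := by
  have ha0 := h.pos_of_mem_reset ha
  obtain ⟨r, -, hg⟩ := h.schedule.exists_gap ha0.le hab
  have h1 := h.timer.le_of_expired a b ha hab (h.of_mem_reset hb hg).1
  have h2 := (h.clock a b ha0.le hab.le).2
  linarith

theorem hold (h : IsBeacon U C d ph inp R X) (hd : 0 < d) {a t : ℝ} (ha : a ∈ R) (hat : a ≤ t)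
    (ht : t ≤ a + 5 * d) : ph t = ph a :=
  h.eq_of_no_reset (h.pos_of_mem_reset ha).le hat fun r hr hrI => by
    have := h.reset_separated hd ha hr hrI.1
    linarith [hrI.2]

/-- In a non-zero phase the beacon needs no input to advance, so it does so when the timer fires,
after at most `7 * d`. In particular an arbitrary initial phase is soon forgotten. -/
theorem exists_reset (h : IsBeacon U C d ph inp R X) {t : ℝ} (ht0 : 0 ≤ t)
    (ht : 7 * d < t) (hp : ph t ≠ 0) : ∃ a ∈ R, t - 7 * d ≤ a ∧ a ≤ t ∧ ph a = ph t := by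
  have hex : ∃ a, (a = 0 ∨ a ∈ R) ∧ 0 ≤ a ∧ a ≤ t ∧ ∀ r ∈ R, r ∉ Ioc a t := by
    by_cases hc : ∃ c ∈ R, c ≤ t
    · obtain ⟨c, hc, hct⟩ := hc
      obtain ⟨e, he, he0, het, hl⟩ := exists_last_of_finite
        ((h.schedule.finite t).subset (inter_subset_inter_left _ h.reset_subset)) hc
        (h.pos_of_mem_reset hc).le hct
      exact ⟨e, Or.inr he, he0, het, hl⟩
    · push Not at hc
      exact ⟨0, Or.inl rfl, le_rfl, ht0, fun r hr hrI => absurd hrI.2 (not_le.2 (hc r hr))⟩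
  obtain ⟨a, ha, ha0, hat, hl⟩ := hex
  by_cases hlt : a + 7 * d < t
  · exfalso
    obtain ⟨u, hu, hau, hua, hXR⟩ := h.timer.fires a ha
    have hnR : u ∉ R := fun hR => hl u hR ⟨hau, by linarith⟩
    have hX := hXR.resolve_right hnR
    obtain ⟨r, har, hg⟩ := h.schedule.exists_gap ha0 hau
    have hr : ph t = ph r := h.eq_of_no_reset hg.nonneg (by linarith [hg.lt]) fun s hs hsI =>
      hl s hs ⟨har.trans_lt hsI.1, hsI.2⟩
    exact hnR (h.advance hu hg hX fun h0 => absurd (hr.trans h0) hp).2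
  · rcases ha with rfl | ha
    · linarith
    · exact ⟨a, ha, by linarith, hat, (h.eq_of_no_reset ha0 hat hl).symm⟩

theorem input_of_on (h : IsBeacon U C d ph inp R X) {t : ℝ} (ht0 : 0 ≤ t) (ht : 7 * d < t)
    (hp : ph t = 1) : ∃ a ∈ U, t - 7 * d ≤ a ∧ a ≤ t ∧ a ∈ inp := by
  obtain ⟨a, ha, hta, hat, hpa⟩ := h.exists_reset ht0 ht (by rw [hp]; decide)
  obtain ⟨r, -, hg⟩ := h.schedule.exists_gap le_rfl (h.pos_of_mem_reset ha)
  obtain ⟨-, hi, hs⟩ := h.of_mem_reset ha hg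
  refine ⟨a, h.reset_subset ha, hta, hat, hi ?_⟩
  rw [hpa, hp] at hs
  revert hs
  generalize ph r = p
  revert p
  decide

/-- Phase 2 was entered from phase 1, which an input started: `7 * d` for each phase, and `d` for
the choice of a time before the change from 1 to 2. -/
theorem input_of_ne_zero (h : IsBeacon U C d ph inp R X) (hd : 0 < d) {t : ℝ} (ht : 16 * d < t)
    (hp : ph t ≠ 0) : ∃ a ∈ U, t - 15 * d ≤ a ∧ a ≤ t ∧ a ∈ inp := by
  by_cases h1 : ph t = 1
  · obtain ⟨a, ha, h2, h3, h4⟩ := h.input_of_on (by linarith) (by linarith) h1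
    exact ⟨a, ha, by linarith, h3, h4⟩
  obtain ⟨b, hb, htb, hbt, hpb⟩ := h.exists_reset (by linarith) (by linarith) hp
  obtain ⟨r, hbr, hg⟩ := h.schedule.exists_gap (a := b - d) (u := b) (by linarith) (by linarith)
  have hr : ph r = 1 := by
    have hs := (h.of_mem_reset hb hg).2.2
    rw [hpb] at hs
    revert hs hp h1
    generalize ph r = p
    generalize ph t = q
    revert p q
    decide
  obtain ⟨a, ha, h2, h3, h4⟩ := h.input_of_on hg.nonneg (by linarith) hr
  exact ⟨a, ha, by linarith, by linarith [hg.lt], h4⟩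

/-- A beacon reacts at once to an input after a period without input. -/
theorem on_of_input (h : IsBeacon U C d ph inp R X) (hd : 0 < d) {t : ℝ} (ht : 30 * d < t)
    (hU : t ∈ U) (hi : t ∈ inp) (hno : ∀ a ∈ U, a ∈ inp → a ∉ Ico (t - 24 * d) t) :
    ph t = 1 ∧ t ∈ R := by
  -- A non-zero phase would require an input during the preceding `15 * d`, and `8 + 15 < 24`. As
  -- the phase is constantly 0, there are no resets, and the timer has expired by time `t`.
  have hz : ∀ r, t - 8 * d ≤ r → r < t → ph r = 0 := fun r hr hrt => by
    by_contra hc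
    obtain ⟨a, ha, h1, h2, h3⟩ := h.input_of_ne_zero hd (by linarith) hc
    exact hno a ha h3 ⟨by linarith, by linarith⟩
  have hX : t ∈ X := by
    refine h.timer.expired_of (t - 7 * d) t (by linarith) (by linarith) (fun r hr hrI => ?_) ?_
    · obtain ⟨s, hs, hg⟩ := h.schedule.exists_gap (a := t - 8 * d) (u := r) (by linarith)
        (by linarith [hrI.1])
      exact (h.mem_reset s r (h.reset_subset hr) hg).1 hr
        ((hz r (by linarith [hrI.1]) hrI.2).trans (hz s hs (hg.lt.trans hrI.2)).symm)
    · linarith [(h.clock (t - 7 * d) t (by linarith) (by linarith)).1]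
  obtain ⟨r, hr, hg⟩ := h.schedule.exists_gap (a := t - 8 * d) (u := t) (by linarith) (by linarith)
  have := h.advance hU hg hX fun _ => hi
  rw [hz r hr hg.lt] at this
  exact ⟨by simpa using this.1, this.2⟩

/-- At most one reset fits into this time, and it leads from phase 1 to phase 2. This is the purpose
of the fading phase: what one node counts as 1 is still non-zero when another node looks slightly
later. -/
theorem ne_zero_of_on (h : IsBeacon U C d ph inp R X) (hd : 0 < d) {s t : ℝ} (hs : 0 ≤ s)
    (hp : ph s = 1) (hst : s ≤ t) (ht : t ≤ s + 5 * d) : ph t ≠ 0 := by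
  by_cases hex : ∃ b ∈ R, s < b ∧ b ≤ t
  · obtain ⟨c, hc, hsc, hct⟩ := hex
    obtain ⟨b, hb, hsb, hbt, hfirst⟩ := exists_first_of_finite (R := R ∩ Ioi s)
      ((h.schedule.finite t).subset
        (inter_subset_inter_left _ (inter_subset_left.trans h.reset_subset))) ⟨hc, hsc⟩ hsc.le hct
    have hsb' : s < b := hb.2
    obtain ⟨r, hsr, hg⟩ := h.schedule.exists_gap hs hsb'
    have hr : ph r = ph s := h.eq_of_no_reset hs hsr fun w hw hwI =>
      hfirst w ⟨hw, hwI.1⟩ ⟨hwI.1.le, hwI.2.trans_lt hg.lt⟩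
    rw [h.hold hd hb.1 hbt (by linarith), (h.of_mem_reset hb.1 hg).2.2, hr, hp]
    decide
  · push Not at hex
    rw [h.eq_of_no_reset hs hst fun r hr hrI => absurd hrI.2 (not_le.2 (hex r hr hrI.1)), hp]
    decide

theorem exists_on_of_level (h : IsBeacon U C d ph inp R X) (hd : 0 < d) (hl : IsLevel U inp)
    {s t : ℝ} (hs : 60 * d < s) (hst : s ≤ t) (ht : t ∈ inp)
    (hno : ∀ a ∈ inp, a ∉ Ico (s - 24 * d) s) : ∃ a ∈ R, s ≤ a ∧ a ≤ t ∧ ph a = 1 := by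
  obtain ⟨u, hu, hut, hlast⟩ := h.schedule.exists_last (t := t) (by linarith)
  have hsu : s ≤ u := by
    by_contra hc
    have h1 : max u (s - d) < s := max_lt (not_le.1 hc) (by linarith)
    -- Without updates since a time before `s`, the input would have held already at that time, in
    -- the period without input.
    refine hno (max u (s - d)) ((hl _ t (le_max_of_le_right (by linarith)) (h1.le.trans hst)
      fun w hw hwI => hlast w hw ⟨(le_max_left _ _).trans_lt hwI.1, hwI.2⟩).1 ht)
      ⟨le_max_of_le_right (by linarith), h1⟩
  have hui : u ∈ inp := (hl u t (by linarith) hut hlast).1 ht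
  obtain ⟨a, ha, hsa, hau, hfirst⟩ := exists_first_of_finite (R := U ∩ inp)
    ((h.schedule.finite u).subset (inter_subset_inter_left _ inter_subset_left)) ⟨hu, hui⟩ hsu le_rfl
  obtain ⟨h1, h2⟩ := h.on_of_input hd (by linarith) ha.1 ha.2 fun b hb hbi hbI => by
    rcases lt_or_ge b s with hbs | hbs
    · exact hno b hbi ⟨by linarith [hbI.1], hbs⟩
    · exact hfirst b ⟨hb, hbi⟩ ⟨hbs, hbI.2⟩
  exact ⟨a, h2, hsa, hau.trans hut, h1⟩

end IsBeacon

/-! ### Acceptors -/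

/-- An acceptor starts an event (a time in `E`) when its input `L` holds, unless another event has
started recently. An event is good if the time since the previous event is in the range given by the
timers of lengths `lo` and `hi`, and the last violation of this is long ago. The acceptor triggers
when the input `N` holds during a good event for the first time; `M` tells that this is still
possible. -/
structure IsAcceptor (U : Set ℝ) (C : ℝ → ℝ) (d lo hi : ℝ) (L N M E G W X Y Z : Set ℝ) :
    Prop where
  schedule : IsSchedule U d
  clock : IsClock C
  timer_window : IsTimer U C d (30 * d) E W
  timer_min : IsTimer U C d lo E X
  timer_max : IsTimer U C d hi E Y
  timer_block : IsTimer U C d (2 * hi) (E \ (X \ Y)) Z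
  level_support : IsLevel U L
  level_accept : IsLevel U N
  level_armed : IsLevel U M
  mem_event : ∀ u, u ∈ E ↔ u ∈ U ∧ u ∈ W ∧ u ∈ L
  trigger_subset : G ⊆ U
  mem_armed : ∀ r u, u ∈ U → Gap U r u →
    (u ∈ M ↔ (u ∈ E ∧ u ∈ (X \ Y) ∩ Z ∨ u ∉ E ∧ r ∈ M ∧ u ∉ W) ∧ u ∉ N)
  mem_trigger : ∀ r u, u ∈ U → Gap U r u →
    (u ∈ G ↔ (u ∈ E ∧ u ∈ (X \ Y) ∩ Z ∨ u ∉ E ∧ r ∈ M ∧ u ∉ W) ∧ u ∈ N)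

namespace IsAcceptor

variable {U : Set ℝ} {C : ℝ → ℝ} {d lo hi : ℝ} {L N M E G W X Y Z : Set ℝ}

theorem event_subset (h : IsAcceptor U C d lo hi L N M E G W X Y Z) : E ⊆ U :=
  fun u hu => ((h.mem_event u).1 hu).1

theorem event_pos (h : IsAcceptor U C d lo hi L N M E G W X Y Z) {e : ℝ} (he : e ∈ E) : 0 < e :=
  h.schedule.pos e (h.event_subset he)

theorem exists_last_event (h : IsAcceptor U C d lo hi L N M E G W X Y Z) {a c t : ℝ} (hc : c ∈ E)
    (hac : a ≤ c) (hct : c ≤ t) : ∃ e ∈ E, a ≤ e ∧ e ≤ t ∧ ∀ r ∈ E, r ∉ Ioc e t :=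
  exists_last_of_finite
    ((h.schedule.finite t).subset (inter_subset_inter_left _ h.event_subset)) hc hac hct

theorem event_separated (h : IsAcceptor U C d lo hi L N M E G W X Y Z) (hd : 0 < d) {a b : ℝ}
    (ha : a ∈ E) (hb : b ∈ E) (hab : a < b) : a + 29 * d < b := by
  have h1 := h.timer_window.le_of_expired a b ha hab ((h.mem_event b).1 hb).2.1
  have h2 := (h.clock a b (h.event_pos ha).le hab.le).2
  linarith

/-- Unless an event starts at `u` itself, the window timer has not expired, so there was an event
recently. The acceptor can still be armed only if the last event was good. -/
theorem event_of_trigger (h : IsAcceptor U C d lo hi L N M E G W X Y Z) (hd : 0 < d) {u : ℝ}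
    (hu : u ∈ G) (hu' : 30 * d ≤ u) :
    ∃ e ∈ E, u - 30 * d ≤ e ∧ e ≤ u ∧ e ∈ (X \ Y) ∩ Z := by
  have huU := h.trigger_subset hu
  by_cases huE : u ∈ E
  · obtain ⟨r, -, hg⟩ := h.schedule.exists_gap le_rfl (h.schedule.pos u huU)
    rcases ((h.mem_trigger r u huU hg).1 hu).1 with h1 | h1
    · exact ⟨u, huE, by linarith, le_rfl, h1.2⟩
    · exact absurd huE h1.1
  have hW : u ∉ W := by
    obtain ⟨r, -, hg⟩ := h.schedule.exists_gap le_rfl (h.schedule.pos u huU)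
    rcases ((h.mem_trigger r u huU hg).1 hu).1 with h1 | h1
    · exact absurd h1.1 huE
    · exact h1.2.2
  have hex : ∃ c ∈ E, u - 30 * d ≤ c ∧ c ≤ u := by
    by_contra hc
    push Not at hc
    refine hW (h.timer_window.expired_of (u - 30 * d) u (by linarith) (by linarith)
      (fun r hr hrI => ?_) ?_)
    · linarith [hc r hr hrI.1.le, hrI.2]
    · linarith [(h.clock (u - 30 * d) u (by linarith) (by linarith)).1]
  obtain ⟨c, hc, hc1, hc2⟩ := hex
  obtain ⟨e, he, he1, heu, hl⟩ := h.exists_last_event hc hc1 hc2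
  have heu' : e < u := lt_of_le_of_ne heu fun he' => huE (he' ▸ he)
  obtain ⟨r, her, hg⟩ := h.schedule.exists_gap (h.event_pos he).le heu'
  have hr : r ∈ M := by
    rcases ((h.mem_trigger r u huU hg).1 hu).1 with h1 | h1
    · exact absurd h1.1 huE
    · exact h1.2.1
  refine ⟨e, he, he1, heu, ?_⟩
  have := h.schedule.induction (Q := fun t => t ∈ M → e ∈ (X \ Y) ∩ Z) (h.event_pos he).le her
    (fun hM => ?_) (fun r t har hrt _ hU hr hM =>
      hr ((h.level_armed r t ((h.event_pos he).le.trans har) hrt hU).1 hM))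
    (fun s w hw hes hg' hwr hs hM => ?_)
  · exact this hr
  · obtain ⟨r, -, hg⟩ := h.schedule.exists_gap le_rfl (h.event_pos he)
    rcases ((h.mem_armed r e (h.event_subset he) hg).1 hM).1 with h1 | h1
    · exact h1.2
    · exact absurd he h1.1
  · rcases ((h.mem_armed s w hw hg').1 hM).1 with h1 | h1
    · exact absurd h1.1 fun hwE => hl w hwE ⟨hes.trans_lt hg'.lt, hwr.trans hg.lt.le⟩
    · exact hs h1.2.1

/-- The distance of a good event from an earlier event. -/
theorem event_distance (h : IsAcceptor U C d lo hi L N M E G W X Y Z) (hhi : 0 < hi)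
    {e e' : ℝ} (he : e ∈ E) (hlt : e < e') (hgood : e' ∈ (X \ Y) ∩ Z)
    (hhi' : hi ≤ e') :
    lo ≤ 1.004 * (e' - e) ∧ (e' - e ≤ hi ∨ 2 * lo ≤ 1.004 * (e' - e)) := by
  have key : ∀ {a b}, a ∈ E → b ∈ X → a < b → lo ≤ 1.004 * (b - a) := fun {a b} ha hb hab =>
    (h.timer_min.le_of_expired a b ha hab hb).trans (h.clock a b (h.event_pos ha).le hab.le).2
  refine ⟨key he hgood.1.1 hlt, ?_⟩
  -- Otherwise the timer of length `hi` would have expired by `e'`.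
  have hex : ∃ c ∈ E, e' - hi < c ∧ c < e' := by
    by_contra hc
    push Not at hc
    refine hgood.1.2 (h.timer_max.expired_of (e' - hi) e' (by linarith) (by linarith)
      (fun r hr hrI => ?_) ?_)
    · linarith [hc r hr hrI.1, hrI.2]
    · linarith [(h.clock (e' - hi) e' (by linarith) (by linarith)).1]
  obtain ⟨c, hc, hc1, hc2⟩ := hex
  -- An irregular `c` would have restarted the timer of length `2 * hi`, which could not have run
  -- down by `e'`.
  have hcX : c ∈ X \ Y := by
    by_contra hn
    have h1 := h.timer_block.le_of_expired c e' ⟨hc, hn⟩ hc2 hgood.2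
    have h2 := (h.clock c e' (h.event_pos hc).le hc2.le).2
    linarith
  -- If `e` is before `c`, local time `lo` elapses from `e` to `c` and again from `c` to `e'`.
  -- Otherwise `e` lies within `hi` of `e'`.
  rcases lt_or_ge e c with hec | hec
  · right
    linarith [key he hcX.1 hec, key hc hgood.1.1 hc2]
  · left
    linarith

/-- If no event had started for so long, the window timer would have expired by the last update up
to `t`. The support holds there too, so this update would be an event. -/
theorem event_of_support (h : IsAcceptor U C d lo hi L N M E G W X Y Z) (hd : 0 < d) {t : ℝ}
    (ht : 32 * d ≤ t) (hL : t ∈ L) : ∃ e ∈ E, t - 31 * d ≤ e ∧ e ≤ t := by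
  by_contra hc
  push Not at hc
  obtain ⟨u, hu, hut, hlast⟩ := h.schedule.exists_last (t := t) (by linarith)
  have hu0 := h.schedule.pos u hu
  have hex : ∃ a, (a = 0 ∨ a ∈ E) ∧ 0 ≤ a ∧ a + 31 * d ≤ t ∧ ∀ r ∈ E, r ∉ Ioc a t := by
    by_cases hcE : ∃ c ∈ E, c ≤ t
    · obtain ⟨c, hc', hct⟩ := hcE
      obtain ⟨e, he, he0, het, hl⟩ := h.exists_last_event hc' (h.event_pos hc').le hct
      refine ⟨e, Or.inr he, he0, ?_, hl⟩
      by_contra hlt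
      linarith [hc e he (by linarith)]
    · push Not at hcE
      exact ⟨0, Or.inl rfl, le_rfl, by linarith,
        fun r hr hrI => absurd hrI.2 (not_le.2 (hcE r hr))⟩
  obtain ⟨a, ha, ha0, hat, hl⟩ := hex
  obtain ⟨w, hw, haw, hwa, hWE⟩ := h.timer_window.fires a ha
  have hwt : w ≤ t := by linarith
  have hwW := hWE.resolve_right fun hE => hl w hE ⟨haw, hwt⟩
  have hwu : w ≤ u := by
    by_contra hlt
    exact hlast w hw ⟨not_le.1 hlt, hwt⟩
  have huW := h.timer_window.expired_mono w u hwW (by linarith) hwu fun r hr hrI =>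
    hl r hr ⟨haw.trans_le hrI.1, hrI.2.le.trans hut⟩
  exact hl u ((h.mem_event u).2 ⟨hu, huW, (h.level_support u t hu0.le hut hlast).1 hL⟩)
    ⟨haw.trans_le hwu, hut⟩

/-- A good event arms the acceptor. Within `29 * d` the window timer cannot expire, so without a new
event the acceptor remains armed until an update at which `N` holds. -/
theorem exists_trigger (h : IsAcceptor U C d lo hi L N M E G W X Y Z) (hd : 0 < d) {e t : ℝ}
    (he : e ∈ E) (hgood : e ∈ (X \ Y) ∩ Z) (het : e ≤ t) (hte : t ≤ e + 29 * d) (ht : t ∈ N)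
    (hno : ∀ r ∈ E, r ∉ Ioc e t) : ∃ u ∈ G, e ≤ u ∧ u ≤ t := by
  by_contra hc
  push Not at hc
  have he0 := h.event_pos he
  have heU := h.event_subset he
  obtain ⟨u, hu, heu, hut, hlast⟩ := exists_last_of_finite (h.schedule.finite t) heU le_rfl het
  have hN : u ∈ N := (h.level_accept u t (he0.le.trans heu) hut hlast).1 ht
  have hM : ∀ r u, u ∈ U → Gap U r u →
      (u ∈ E ∧ u ∈ (X \ Y) ∩ Z ∨ u ∉ E ∧ r ∈ M ∧ u ∉ W) → e ≤ u → u ≤ t → u ∈ M ∧ u ∉ N := by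
    intro r u hu hg hcand heu hut
    have hnN : u ∉ N := fun hN => absurd (hc u ((h.mem_trigger r u hu hg).2 ⟨hcand, hN⟩) heu)
      (not_lt.2 hut)
    exact ⟨(h.mem_armed r u hu hg).2 ⟨hcand, hnN⟩, hnN⟩
  have hcand : ∀ r u, e ≤ r → Gap U r u → u ≤ t → r ∈ M → u ∉ E ∧ r ∈ M ∧ u ∉ W := by
    intro r u her hg hut hr
    have heu := her.trans_lt hg.lt
    refine ⟨fun hE => hno u hE ⟨heu, hut⟩, hr, fun hW => ?_⟩
    have h1 := h.timer_window.le_of_expired e u he heu hW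
    have h2 := (h.clock e u he0.le heu.le).2
    linarith
  have hbase : e ∈ M ∧ e ∉ N := by
    obtain ⟨r, -, hg⟩ := h.schedule.exists_gap le_rfl he0
    exact hM r e heU hg (Or.inl ⟨he, hgood⟩) le_rfl het
  rcases heu.eq_or_lt with rfl | heu'
  · exact hbase.2 hN
  obtain ⟨r, her, hg⟩ := h.schedule.exists_gap he0.le heu'
  have hr : r ∈ M := h.schedule.induction (Q := fun t => t ∈ M) he0.le her hbase.1
    (fun r t har hrt _ hU hr => (h.level_armed r t (he0.le.trans har) hrt hU).2 hr)
    (fun s w hw hes hg' hwr hs => by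
      have hwt : w ≤ t := hwr.trans (hg.lt.le.trans hut)
      exact (hM s w hw hg' (Or.inr (hcand s w hes hg' hwt hs)) (hes.trans hg'.lt.le) hwt).1)
  exact (hM r u hu hg (Or.inr (hcand r u her hg hut hr)) heu hut).2 hN

/-- A trigger disarms the acceptor, and only an event arms it again. -/
theorem not_trigger_twice (h : IsAcceptor U C d lo hi L N M E G W X Y Z) {u w : ℝ} (hu : u ∈ G)
    (hw : w ∈ G) (huw : u < w) (hno : ∀ r ∈ E, r ∉ Ioc u w) : False := by
  have huU := h.trigger_subset hu
  have hu0 := h.schedule.pos u huU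
  have huM : u ∉ M := fun hM => by
    obtain ⟨r, -, hg⟩ := h.schedule.exists_gap le_rfl hu0
    exact ((h.mem_armed r u huU hg).1 hM).2 ((h.mem_trigger r u huU hg).1 hu).2
  obtain ⟨r, hur, hg⟩ := h.schedule.exists_gap hu0.le huw
  have hr : r ∉ M := h.schedule.induction (Q := fun t => t ∉ M) hu0.le hur huM
    (fun r t har hrt _ hU hr hM => hr ((h.level_armed r t (hu0.le.trans har) hrt hU).1 hM))
    (fun s t ht hus hg' htr hs hM => by
      rcases ((h.mem_armed s t ht hg').1 hM).1 with h1 | h1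
      · exact hno t h1.1 ⟨hus.trans_lt hg'.lt, htr.trans hg.lt.le⟩
      · exact hs h1.2.1)
  rcases ((h.mem_trigger r w (h.trigger_subset hw) hg).1 hw).1 with h1 | h1
  · exact hno w h1.1 ⟨huw, le_rfl⟩
  · exact hr h1.2.1

end IsAcceptor

/-! ### Voting on the pulses of a block -/

/-- All nodes vote on the pulses of the nodes in the block `D`. Here `src u` and `vote u` are the
beacons by which `u` announces its pulses and its votes; `srcIn v t u` and `voteIn v t u` are the
values that `v` has last received from `u` by time `t`. A node `v` votes when it sees the beacons of
more than `fb` nodes of `D`, and triggers at the times in `trig v`, depending on the votes. -/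
structure IsVoting {V : Type} [Fintype V] (F D : Finset V) (f fb : ℕ) (d lo hi : ℝ) (U : V → Set ℝ) (C : V → ℝ → ℝ)
    (pulse : V → Set ℝ) (src vote : V → ℝ → Fin 3) (srcIn voteIn : V → ℝ → V → Fin 3)
    (E Q trig : V → Set ℝ) : Prop where
  card_faulty : F.card ≤ f
  card_lt : 3 * f < Fintype.card V
  delay_pos : 0 < d
  pulse_subset : ∀ v, v ∉ F → pulse v ⊆ U v
  source : ∀ v ∈ D, v ∉ F → ∃ R X, IsBeacon (U v) (C v) d (src v) (pulse v) R X
  voter : ∀ v, v ∉ F → ∃ R X, IsBeacon (U v) (C v) d (vote v)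
    {t | fb < (D.filter fun u => srcIn v t u = 1).card} R X
  level_source : ∀ v, v ∉ F → IsLevel (U v) {t | fb < (D.filter fun u => srcIn v t u = 1).card}
  acceptor : ∀ v, v ∉ F → ∃ M W X Y Z, Q v = (X \ Y) ∩ Z ∧ IsAcceptor (U v) (C v) d lo hi
    {t | f < (Finset.univ.filter fun u => voteIn v t u ≠ 0).card}
    {t | Fintype.card V ≤ (Finset.univ.filter fun u => voteIn v t u = 1).card + f}
    M (E v) (trig v) W X Y Z
  received : ∀ v, v ∉ F → ∀ u, u ∉ F → ∀ t, d ≤ t → ∃ s, 0 ≤ s ∧ t - d < s ∧ s < t ∧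
    srcIn v t u = src u s ∧ voteIn v t u = vote u s

namespace IsVoting

variable {V : Type} [Fintype V] {F D : Finset V} {f fb : ℕ} {d lo hi : ℝ} {U : V → Set ℝ} {C : V → ℝ → ℝ}
  {pulse : V → Set ℝ} {src vote : V → ℝ → Fin 3} {srcIn voteIn : V → ℝ → V → Fin 3}
  {E Q trig : V → Set ℝ}

/-- If a correct node sees enough votes to trigger, then all correct nodes see many votes. -/
theorem support_of_accept (h : IsVoting F D f fb d lo hi U C pulse src vote srcIn voteIn E Q trig)
    {v w : V} (hv : v ∉ F) (hw : w ∉ F) {a : ℝ} (ha : d ≤ a)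
    (hN : Fintype.card V ≤ (Finset.univ.filter fun u => voteIn v a u = 1).card + f) :
    f < (Finset.univ.filter fun u => voteIn w (a + d) u ≠ 0).card := by
  classical
  have hd := h.delay_pos
  -- At least `n - 2 * f > f` of the votes seen by `v` are from correct nodes. What `w` sees at `a +
  -- d` was sent less than `2 * d` later, when these beacons are still non-zero.
  have hsub : (Finset.univ.filter fun u => voteIn v a u = 1) \ F ⊆
      Finset.univ.filter fun u => voteIn w (a + d) u ≠ 0 := by
    intro u hu
    simp only [Finset.mem_sdiff, Finset.mem_filter, Finset.mem_univ, true_and] at hu ⊢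
    obtain ⟨s, hs0, has, hsa, -, hs⟩ := h.received v hv u hu.2 a ha
    obtain ⟨s', -, has', hsa', -, hs'⟩ := h.received w hw u hu.2 (a + d) (by linarith)
    obtain ⟨R, X, hb⟩ := h.voter u hu.2
    rw [hs']
    exact hb.ne_zero_of_on hd hs0 (hs.symm.trans hu.1) (by linarith) (by linarith)
  have h1 := Finset.card_le_card hsub
  have h2 := Finset.le_card_sdiff F (Finset.univ.filter fun u => voteIn v a u = 1)
  have h3 := h.card_faulty
  have h4 := h.card_lt
  omega

/-- Restrictions on the distance of two triggers of correct nodes. -/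
theorem trigger_distance (h : IsVoting F D f fb d lo hi U C pulse src vote srcIn voteIn E Q trig)
    (hhi : 0 < hi) {v w : V} (hv : v ∉ F) (hw : w ∉ F) {a b : ℝ} (ha : a ∈ trig v)
    (hb : b ∈ trig w) (had : 40 * d ≤ a) (hab : a + 32 * d ≤ b) (hhib : hi + 30 * d ≤ b) :
    lo ≤ 1.004 * (b - a + 30 * d) ∧
      (b - a - 31 * d ≤ hi ∨ 2 * lo ≤ 1.004 * (b - a + 30 * d)) := by
  have hd := h.delay_pos
  obtain ⟨M, W, X, Y, Z, -, hA⟩ := h.acceptor v hv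
  obtain ⟨M', W', X', Y', Z', -, hA'⟩ := h.acceptor w hw
  have hN : Fintype.card V ≤ (Finset.univ.filter fun u => voteIn v a u = 1).card + f := by
    have haU := hA.trigger_subset ha
    obtain ⟨r, -, hg⟩ := hA.schedule.exists_gap le_rfl (hA.schedule.pos a haU)
    exact ((hA.mem_trigger r a haU hg).1 ha).2
  -- The trigger of `v` leaves its trace as an event of `w`, so that only events of a single node
  -- have to be compared.
  have hL := h.support_of_accept hv hw (by linarith) hN
  obtain ⟨e, he, hae, hea⟩ := hA'.event_of_support hd (t := a + d) (by linarith) hL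
  obtain ⟨e', he', hbe', heb', hgood⟩ := hA'.event_of_trigger hd hb (by linarith)
  obtain ⟨h1, h2⟩ := hA'.event_distance hhi he (by linarith) hgood (by linarith)
  refine ⟨by linarith, h2.imp (fun h => by linarith) fun h => by linarith⟩

end IsVoting

/-- From time `t₀` on, the correct nodes of the block `D` pulse in windows of length `2 * d` that
start at the times `q k`. -/
structure IsPulsing {V : Type} [DecidableEq V] (F D : Finset V) (fb : ℕ) (d T T' t₀ : ℝ) (pulse : V → Set ℝ) (q : ℕ → ℝ) :
    Prop where
  card_faulty : (D ∩ F).card ≤ fb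
  card_lt : 3 * fb < D.card
  start_nonneg : 0 ≤ t₀
  start_le : t₀ ≤ q 0
  step_le : ∀ k, q k + T ≤ q (k + 1)
  le_step : ∀ k, q (k + 1) ≤ q k + T'
  window : ∀ v ∈ D, v ∉ F → ∀ s ∈ pulse v, t₀ ≤ s → ∃ k, q k ≤ s ∧ s < q k + 2 * d
  exists_pulse : ∀ v ∈ D, v ∉ F → ∀ k, ∃ s ∈ pulse v, q k ≤ s ∧ s < q k + 2 * d
  delay_le : 1000 * d ≤ T
  period_le : T' ≤ 1.05 * T

namespace IsPulsing

variable {V : Type} [DecidableEq V] {F D : Finset V} {f fb : ℕ} {d lo hi : ℝ} {U : V → Set ℝ} {C : V → ℝ → ℝ}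
  {pulse : V → Set ℝ} {src vote : V → ℝ → Fin 3} {srcIn voteIn : V → ℝ → V → Fin 3}
  {E Q trig : V → Set ℝ} {T T' t₀ : ℝ} {q : ℕ → ℝ}

theorem add_le_of_lt (hp : IsPulsing F D fb d T T' t₀ pulse q) (hT : 0 < T) {j k : ℕ}
    (hjk : j < k) : q j + T ≤ q k := by
  have hm : Monotone q := monotone_nat_of_le_succ fun k => by linarith [hp.step_le k]
  exact (hp.step_le j).trans (hm hjk)

theorem start_le_all (hp : IsPulsing F D fb d T T' t₀ pulse q) (hT : 0 < T) (k : ℕ) :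
    t₀ ≤ q k := by
  have hm : Monotone q := monotone_nat_of_le_succ fun k => by linarith [hp.step_le k]
  exact hp.start_le.trans (hm (Nat.zero_le k))

theorem period_pos [Fintype V] (hp : IsPulsing F D fb d T T' t₀ pulse q)
    (h : IsVoting F D f fb d lo hi U C pulse src vote srcIn voteIn E Q trig)
    : 0 < T := by
  linarith [hp.delay_le, h.delay_pos]

/-- The delays add up along the chain from pulses to events: skew `2 * d` and phase 1 for `7 * d`
here, then `d` until seen, `15 * d` for a vote to vanish, and `d` until that is seen, giving 9, 10,
25 and 26. -/
theorem window_of_source [Fintype V] (hp : IsPulsing F D fb d T T' t₀ pulse q)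
    (h : IsVoting F D f fb d lo hi U C pulse src vote srcIn voteIn E Q trig)
    {v : V} (hvD : v ∈ D) (hv : v ∉ F) {t : ℝ} (ht : t₀ + 100 * d ≤ t)
    (hon : src v t = 1) : ∃ k, q k ≤ t ∧ t < q k + 9 * d := by
  have hd := h.delay_pos
  have h0 := hp.start_nonneg
  obtain ⟨R, X, hb⟩ := h.source v hvD hv
  obtain ⟨a, -, h1, h2, ha⟩ := hb.input_of_on (by linarith) (by linarith) hon
  obtain ⟨k, hk, hk'⟩ := hp.window v hvD hv a ha (by linarith)
  exact ⟨k, by linarith, by linarith⟩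

theorem window_of_seen [Fintype V] (hp : IsPulsing F D fb d T T' t₀ pulse q)
    (h : IsVoting F D f fb d lo hi U C pulse src vote srcIn voteIn E Q trig)
    {v : V} (hv : v ∉ F) {t : ℝ} (ht : t₀ + 101 * d ≤ t)
    (hs : fb < (D.filter fun u => srcIn v t u = 1).card) : ∃ k, q k ≤ t ∧ t < q k + 10 * d := by
  have hd := h.delay_pos
  have h0 := hp.start_nonneg
  have hex : ∃ u ∈ D.filter fun u => srcIn v t u = 1, u ∉ F := by
    by_contra hc
    push Not at hc
    have hsub : (D.filter fun u => srcIn v t u = 1) ⊆ D ∩ F := fun u hu =>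
      Finset.mem_inter.2 ⟨(Finset.mem_filter.1 hu).1, hc u hu⟩
    have := Finset.card_le_card hsub
    have := hp.card_faulty
    omega
  obtain ⟨u, hu, huF⟩ := hex
  obtain ⟨huD, hu1⟩ := Finset.mem_filter.1 hu
  obtain ⟨s, -, h1, h2, hs, -⟩ := h.received v hv u huF t (by linarith)
  obtain ⟨k, hk, hk'⟩ := hp.window_of_source h huD huF (t := s) (by linarith) (hs.symm.trans hu1)
  exact ⟨k, by linarith, by linarith⟩

theorem window_of_vote [Fintype V] (hp : IsPulsing F D fb d T T' t₀ pulse q)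
    (h : IsVoting F D f fb d lo hi U C pulse src vote srcIn voteIn E Q trig)
    {v : V} (hv : v ∉ F) {t : ℝ} (ht : t₀ + 120 * d ≤ t)
    (hon : vote v t ≠ 0) : ∃ k, q k ≤ t ∧ t < q k + 25 * d := by
  have hd := h.delay_pos
  have h0 := hp.start_nonneg
  obtain ⟨R, X, hb⟩ := h.voter v hv
  obtain ⟨a, -, h1, h2, ha⟩ := hb.input_of_ne_zero hd (by linarith) hon
  obtain ⟨k, hk, hk'⟩ := hp.window_of_seen h hv (t := a) (by linarith) ha
  exact ⟨k, by linarith, by linarith⟩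

theorem window_of_event [Fintype V] (hp : IsPulsing F D fb d T T' t₀ pulse q)
    (h : IsVoting F D f fb d lo hi U C pulse src vote srcIn voteIn E Q trig)
    {v : V} (hv : v ∉ F) {e : ℝ} (he : e ∈ E v) (ht : t₀ + 130 * d ≤ e) :
    ∃ k, q k ≤ e ∧ e < q k + 26 * d := by
  have hd := h.delay_pos
  have h0 := hp.start_nonneg
  obtain ⟨M, W, X, Y, Z, -, hA⟩ := h.acceptor v hv
  have hL : f < (Finset.univ.filter fun u => voteIn v e u ≠ 0).card := ((hA.mem_event e).1 he).2.2
  obtain ⟨u, hu, huF⟩ := Finset.exists_mem_notMem_of_card_lt_card (h.card_faulty.trans_lt hL)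
  obtain ⟨s, -, h1, h2, -, hs⟩ := h.received v hv u huF e (by linarith)
  obtain ⟨k, hk, hk'⟩ := hp.window_of_vote h huF (t := s) (by linarith)
    (hs ▸ (Finset.mem_filter.1 hu).2)
  exact ⟨k, by linarith, by linarith⟩

/-- Windows are so far apart that the beacon has had no input for `24 * d` before the first pulse in
the window. It turns on at once and remains on for `5 * d`. Index 0 is excluded because pulses
before `t₀` are arbitrary. -/
theorem source_on [Fintype V] (hp : IsPulsing F D fb d T T' t₀ pulse q)
    (h : IsVoting F D f fb d lo hi U C pulse src vote srcIn voteIn E Q trig)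
    {v : V} (hvD : v ∈ D) (hv : v ∉ F) {k : ℕ} (hk : 1 ≤ k) {t : ℝ}
    (ht : q k + 2 * d ≤ t) (ht' : t ≤ q k + 5 * d) : src v t = 1 := by
  have hd := h.delay_pos
  have h0 := hp.start_nonneg
  have hT := hp.period_pos h
  have h1 := hp.add_le_of_lt hT hk
  have hs0 := hp.start_le
  have hTd := hp.delay_le
  obtain ⟨R, X, hb⟩ := h.source v hvD hv
  obtain ⟨c, hc, hqc, hcq⟩ := hp.exists_pulse v hvD hv k
  obtain ⟨s, hs, hqs, hsc, hfirst⟩ := exists_first_of_finite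
    ((hb.schedule.finite c).subset (inter_subset_inter_left _ (h.pulse_subset v hv))) hc hqc le_rfl
  obtain ⟨hon, hR⟩ := hb.on_of_input hd (t := s) (by linarith) (h.pulse_subset v hv hs) hs
    fun a _ ha haI => by
      rcases lt_or_ge a (q k) with hlt | hge
      · obtain ⟨j, hj, hj'⟩ := hp.window v hvD hv a ha (by linarith [haI.1])
        rcases lt_or_ge j k with hjk | hjk
        · have := hp.add_le_of_lt hT hjk
          linarith [haI.1]
        · rcases hjk.eq_or_lt with rfl | hjk
          · linarith
          · have := hp.add_le_of_lt hT hjk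
            linarith
      · exact hfirst a ha ⟨hge, haI.2⟩
  rw [hb.hold hd hR (by linarith) (by linarith), hon]

/-- By `q k + 3 * d` all correct nodes of the block are seen to be on, and these are more than `fb`.
No enough announcements were seen shortly before `q k`, so the vote starts in `[q k, q k + 3 * d]`
and lasts until `q k + 5 * d`. -/
theorem vote_on [Fintype V] (hp : IsPulsing F D fb d T T' t₀ pulse q)
    (h : IsVoting F D f fb d lo hi U C pulse src vote srcIn voteIn E Q trig)
    {w : V} (hw : w ∉ F) {k : ℕ} (hk : 1 ≤ k) {t : ℝ}
    (ht : q k + 3 * d ≤ t) (ht' : t ≤ q k + 5 * d) : vote w t = 1 := by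
  have hd := h.delay_pos
  have h0 := hp.start_nonneg
  have hT := hp.period_pos h
  have h1 := hp.add_le_of_lt hT hk
  have hs0 := hp.start_le
  have hTd := hp.delay_le
  obtain ⟨R, X, hb⟩ := h.voter w hw
  have hseen : q k + 3 * d ∈ {t | fb < (D.filter fun u => srcIn w t u = 1).card} := by
    have hsub : D \ F ⊆ D.filter fun u => srcIn w (q k + 3 * d) u = 1 := by
      intro u hu
      obtain ⟨huD, huF⟩ := Finset.mem_sdiff.1 hu
      refine Finset.mem_filter.2 ⟨huD, ?_⟩
      obtain ⟨s, -, h2, h3, hs, -⟩ := h.received w hw u huF (q k + 3 * d) (by linarith)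
      rw [hs]
      exact hp.source_on h huD huF hk (by linarith) (by linarith)
    have h2 := Finset.card_le_card hsub
    have h3 := Finset.card_sdiff_add_card_inter D F
    have h4 := hp.card_faulty
    have h5 := hp.card_lt
    simp only [mem_ofPred_eq]
    omega
  obtain ⟨a, ha, hqa, haq, hon⟩ := hb.exists_on_of_level hd (h.level_source w hw) (s := q k)
    (by linarith) (by linarith) hseen fun a ha haI => by
      obtain ⟨j, hj, hj'⟩ := hp.window_of_seen h hw (t := a) (by linarith [haI.1]) ha
      rcases lt_or_ge j k with hjk | hjk
      · have := hp.add_le_of_lt hT hjk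
        linarith [haI.1]
      · rcases hjk.eq_or_lt with rfl | hjk
        · linarith [haI.2]
        · have := hp.add_le_of_lt hT hjk
          linarith [haI.2]
  rw [hb.hold hd ha (by linarith) (by linarith), hon]

theorem accept [Fintype V] (hp : IsPulsing F D fb d T T' t₀ pulse q)
    (h : IsVoting F D f fb d lo hi U C pulse src vote srcIn voteIn E Q trig)
    {w : V} (hw : w ∉ F) {k : ℕ} (hk : 1 ≤ k) :
    Fintype.card V ≤ (Finset.univ.filter fun u => voteIn w (q k + 4 * d) u = 1).card + f := by
  have hd := h.delay_pos
  have h0 := hp.start_nonneg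
  have h1 := hp.start_le_all (hp.period_pos h) k
  have hsub : Finset.univ \ F ⊆ Finset.univ.filter fun u => voteIn w (q k + 4 * d) u = 1 := by
    intro u hu
    have huF := (Finset.mem_sdiff.1 hu).2
    refine Finset.mem_filter.2 ⟨Finset.mem_univ _, ?_⟩
    obtain ⟨s, -, h2, h3, -, hs⟩ := h.received w hw u huF (q k + 4 * d) (by linarith)
    rw [hs]
    exact hp.vote_on h huF hk (by linarith) (by linarith)
  have h2 := Finset.card_le_card hsub
  have h3 := Finset.le_card_sdiff F Finset.univ
  have h4 := h.card_faulty
  rw [Finset.card_univ] at h3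
  omega

theorem exists_event [Fintype V] (hp : IsPulsing F D fb d T T' t₀ pulse q)
    (h : IsVoting F D f fb d lo hi U C pulse src vote srcIn voteIn E Q trig)
    {w : V} (hw : w ∉ F) {k : ℕ} (hk : 1 ≤ k) :
    ∃ e ∈ E w, q k ≤ e ∧ e ≤ q k + 4 * d := by
  have hd := h.delay_pos
  have h0 := hp.start_nonneg
  have hT := hp.period_pos h
  have h1 := hp.add_le_of_lt hT hk
  have hs0 := hp.start_le
  have hTd := hp.delay_le
  obtain ⟨M, W, X, Y, Z, -, hA⟩ := h.acceptor w hw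
  have hN := hp.accept h hw hk
  have hL : f < (Finset.univ.filter fun u => voteIn w (q k + 4 * d) u ≠ 0).card := by
    have hsub : (Finset.univ.filter fun u => voteIn w (q k + 4 * d) u = 1) ⊆
        Finset.univ.filter fun u => voteIn w (q k + 4 * d) u ≠ 0 :=
      Finset.monotone_filter_right _ fun u _ hu => by rw [hu]; decide
    have h2 := Finset.card_le_card hsub
    have h4 := h.card_lt
    omega
  obtain ⟨e, he, h2, h3⟩ := hA.event_of_support hd (t := q k + 4 * d) (by linarith) hL
  refine ⟨e, he, ?_, h3⟩
  obtain ⟨j, hj, hj'⟩ := hp.window_of_event h hw he (by linarith)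
  rcases lt_or_ge j k with hjk | hjk
  · have := hp.add_le_of_lt hT hjk
    linarith
  · rcases hjk.eq_or_lt with rfl | hjk
    · exact hj
    · have := hp.add_le_of_lt hT hjk
      linarith

/-- Events occur less than `26 * d` after the start of a window and are more than `29 * d` apart, so
a window has room for only one. -/
theorem event_unique [Fintype V] (hp : IsPulsing F D fb d T T' t₀ pulse q)
    (h : IsVoting F D f fb d lo hi U C pulse src vote srcIn voteIn E Q trig)
    {w : V} (hw : w ∉ F) {k : ℕ} (hk : 1 ≤ k) {e : ℝ} (he : e ∈ E w)
    (hqe : q k ≤ e) (heq : e ≤ q k + 4 * d) {r : ℝ} (hr : r ∈ E w) (hqr : q k - T / 2 ≤ r)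
    (hrq : r ≤ q k + T / 2) : r = e := by
  have hd := h.delay_pos
  have h0 := hp.start_nonneg
  have hT := hp.period_pos h
  have h1 := hp.add_le_of_lt hT hk
  have hs0 := hp.start_le
  have hTd := hp.delay_le
  obtain ⟨M, W, X, Y, Z, -, hA⟩ := h.acceptor w hw
  obtain ⟨j, hj, hj'⟩ := hp.window_of_event h hw hr (by linarith)
  rcases lt_trichotomy j k with hjk | rfl | hjk
  · have := hp.add_le_of_lt hT hjk
    linarith
  · rcases lt_trichotomy r e with hlt | heq | hlt
    · have := hA.event_separated hd hr he hlt
      linarith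
    · exact heq
    · have := hA.event_separated hd he hr hlt
      linarith
  · have := hp.add_le_of_lt hT hjk
    linarith

/-- The distance of consecutive events differs from that of the windows by at most `4 * d`, and the
clock rate is at most `1.004`. In `hi` there is one more `d`, since the timer must not have expired
even in the extreme case. -/
theorem event_regular [Fintype V] (hp : IsPulsing F D fb d T T' t₀ pulse q)
    (h : IsVoting F D f fb d lo hi U C pulse src vote srcIn voteIn E Q trig)
    (hlo : lo = T - 4 * d) (hhi : hi = 1.004 * (T' + 5 * d)) {w : V}
    (hw : w ∉ F) {k : ℕ} (hk : 1 ≤ k) {X Y : Set ℝ} (hX : IsTimer (U w) (C w) d lo (E w) X)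
    (hY : IsTimer (U w) (C w) d hi (E w) Y) (hC : IsClock (C w)) {e : ℝ} (he : e ∈ E w)
    (hqe : q (k + 1) ≤ e) (heq : e ≤ q (k + 1) + 4 * d) : e ∈ X \ Y := by
  have hd := h.delay_pos
  have h0 := hp.start_nonneg
  have hT := hp.period_pos h
  have hTd := hp.delay_le
  have h1 := hp.step_le k
  have h1' := hp.le_step k
  have hs := hp.start_le_all hT k
  obtain ⟨e₁, he₁, hqe₁, heq₁⟩ := hp.exists_event h hw hk
  have hlt : e₁ < e := by linarith
  have hcl := hC e₁ e (by linarith) hlt.le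
  refine ⟨hX.expired_of e₁ e (by linarith) hlt (fun r hr hrI => ?_) (by linarith), fun heY => ?_⟩
  · rcases le_total r (q k + T / 2) with hle | hle
    · exact hrI.1.ne' (hp.event_unique h hw hk he₁ hqe₁ heq₁ hr (by linarith [hrI.1]) hle)
    · obtain ⟨j, hj, hj'⟩ := hp.window_of_event h hw hr (by linarith [hp.start_le_all hT k])
      rcases lt_or_ge k j with hjk | hjk
      · rcases (Nat.succ_le_of_lt hjk).eq_or_lt with rfl | hjk'
        · exact hrI.2.ne (hp.event_unique h hw (by omega) he hqe heq hr
            (by linarith) (by linarith [hrI.2]))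
        · have := hp.add_le_of_lt hT hjk'
          linarith [hrI.2]
      · rcases hjk.eq_or_lt with rfl | hjk'
        · linarith
        · have := hp.add_le_of_lt hT hjk'
          linarith [hrI.1]
  · have := hY.le_of_expired e₁ e he₁ hlt heY
    linarith

/-- The event in window 1 may be irregular, as its predecessor is not controlled, but later ones are
regular. From window 1 to window 4 there is time of about `3 * T`, whereas `2 * hi` is about `2.11 *
T` at most, so the blocking timer has expired. -/
theorem event_good [Fintype V] (hp : IsPulsing F D fb d T T' t₀ pulse q)
    (h : IsVoting F D f fb d lo hi U C pulse src vote srcIn voteIn E Q trig)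
    (hlo : lo = T - 4 * d) (hhi : hi = 1.004 * (T' + 5 * d)) {w : V}
    (hw : w ∉ F) {k : ℕ} (hk : 4 ≤ k) {e : ℝ} (he : e ∈ E w) (hqe : q k ≤ e)
    (heq : e ≤ q k + 4 * d) : e ∈ Q w := by
  have hd := h.delay_pos
  have h0 := hp.start_nonneg
  have hT := hp.period_pos h
  have hTd := hp.delay_le
  have hT' := hp.period_le
  obtain ⟨M, W, X, Y, Z, hQ, hA⟩ := h.acceptor w hw
  rw [hQ]
  have hreg : ∀ {j r}, 2 ≤ j → r ∈ E w → q j ≤ r → r ≤ q j + 4 * d → r ∈ X \ Y := by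
    intro j r hj hr h1 h2
    obtain ⟨j, rfl⟩ : ∃ i, j = i + 1 := ⟨j - 1, by omega⟩
    exact hp.event_regular h hlo hhi hw (by omega) hA.timer_min hA.timer_max hA.clock hr h1 h2
  refine ⟨hreg (by omega) he hqe heq, ?_⟩
  obtain ⟨e₁, he₁, hqe₁, heq₁⟩ := hp.exists_event h hw le_rfl
  have h1 := hp.step_le 0
  have h2 := hp.step_le 1
  have h3 := hp.step_le 2
  have h4 := hp.step_le 3
  have h5 := hp.start_le
  norm_num at h1 h2 h3 h4
  have hk4 : q 4 ≤ q k := by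
    rcases hk.eq_or_lt with rfl | hlt
    · exact le_rfl
    · linarith [hp.add_le_of_lt hT hlt]
  have hlt : e₁ < e := by linarith
  refine hA.timer_block.expired_of e₁ e (by linarith) hlt (fun r hr hrI => hr.2 ?_)
    (by linarith [(hA.clock e₁ e (by linarith) hlt.le).1])
  obtain ⟨j, hj, hj'⟩ := hp.window_of_event h hw hr.1 (by linarith [hrI.1])
  have hj2 : 2 ≤ j := by
    by_contra hc
    obtain rfl | rfl : j = 0 ∨ j = 1 := by omega
    · linarith [hrI.1]
    · exact hrI.1.ne' (hp.event_unique h hw le_rfl he₁ hqe₁ heq₁ hr.1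
        (by linarith) (by linarith))
  obtain ⟨e₂, he₂, hqe₂, heq₂⟩ := hp.exists_event h hw (k := j) (by omega)
  have := hp.event_unique h hw (by omega) he₂ hqe₂ heq₂ hr.1 (by linarith) (by linarith)
  rw [this]
  exact hreg hj2 he₂ hqe₂ heq₂

/-- Pulses of a block that has stabilised make all correct nodes trigger. -/
theorem exists_unique_trigger [Fintype V] (hp : IsPulsing F D fb d T T' t₀ pulse q)
    (h : IsVoting F D f fb d lo hi U C pulse src vote srcIn voteIn E Q trig)
    (hlo : lo = T - 4 * d) (hhi : hi = 1.004 * (T' + 5 * d)) {w : V}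
    (hw : w ∉ F) {k : ℕ} (hk : 4 ≤ k) : ∃ r ∈ trig w, q k ≤ r ∧ r < q k + 5 * d ∧
      ∀ r' ∈ trig w, q k ≤ r' → r' ≤ q k + T / 2 → r' = r := by
  have hd := h.delay_pos
  have h0 := hp.start_nonneg
  have hT := hp.period_pos h
  have hTd := hp.delay_le
  have hs := hp.start_le
  have h1 := hp.add_le_of_lt hT (show 0 < k by omega)
  obtain ⟨e, he, hqe, heq⟩ := hp.exists_event h hw (k := k) (by omega)
  have hgood := hp.event_good h hlo hhi hw hk he hqe heq
  have huniq : ∀ {r}, r ∈ E w → q k - T / 2 ≤ r → r ≤ q k + T / 2 → r = e := fun hr h1 h2 =>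
    hp.event_unique h hw (by omega) he hqe heq hr h1 h2
  have hN := hp.accept h hw (k := k) (by omega)
  obtain ⟨M, W, X, Y, Z, hQ, hA⟩ := h.acceptor w hw
  rw [hQ] at hgood
  obtain ⟨r, hr, her, hrq⟩ := hA.exists_trigger hd he hgood heq (by linarith) hN fun r hr hrI =>
    hrI.1.ne' (huniq hr (by linarith [hrI.1]) (by linarith [hrI.2]))
  refine ⟨r, hr, by linarith, by linarith, fun r' hr' h2 h3 => ?_⟩
  have her' : e ≤ r' := by
    obtain ⟨e₀, he₀, h4, h5, -⟩ := hA.event_of_trigger hd hr' (by linarith)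
    rw [← huniq he₀ (by linarith) (by linarith)]
    exact h5
  rcases lt_trichotomy r' r with hlt | heq | hlt
  · exact (hA.not_trigger_twice hr' hr hlt fun x hx hxI =>
      (her'.trans_lt hxI.1).ne' (huniq hx (by linarith [hxI.1]) (by linarith [hxI.2]))).elim
  · exact heq
  · exact (hA.not_trigger_twice hr hr' hlt fun x hx hxI =>
      (her.trans_lt hxI.1).ne' (huniq hx (by linarith [hxI.1]) (by linarith [hxI.2]))).elim

end IsPulsing

/-! ### The resynchronisation algorithm -/

structure ResyncParams where
  /-- maximum message delay -/
  d : ℝ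
  /-- local time between two events of a block is at least `lo` and less than `hi` -/
  lo : Bool → ℝ
  hi : Bool → ℝ
  /-- number of faults, in total and in each block -/
  faults : ℕ
  blockFaults : Bool → ℕ
  d_pos : 0 < d
  lo_pos : ∀ i, 0 < lo i
  hi_pos : ∀ i, 0 < hi i

namespace Resync

variable {W₀ W₁ : Type} (A₀ : Algorithm W₀) (A₁ : Algorithm W₁)

/-- Timers: those of the two algorithms, one for each beacon, and four for each acceptor. -/
abbrev Timer : Type := Fin A₀.timers ⊕ Fin A₁.timers ⊕ Option Bool ⊕ Bool × Fin 4

/-- Symbols: those of the two algorithms, and the phases of all beacons. -/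
abbrev Symbol : Type := (A₀.Sym ⊕ A₁.Sym) ⊕ (Option Bool → Fin 3)

/-- The states of the two algorithms, the phases of the beacon for own pulses (`none`) and for votes
on each block, the acceptors that may still trigger, the timers that were reset and the acceptors
that triggered in the last update, and a bit that changes with each update. -/
structure State where
  fst : A₀.State
  snd : A₁.State
  phase : Option Bool → Fin 3
  armed : Set Bool
  resets : Set (Timer A₀ A₁)
  trigger : Set Bool
  toggle : Bool

instance : Finite (State A₀ A₁) := by
  have := A₀.finite_state
  have := A₁.finite_state
  refine Finite.of_injective (fun s : State A₀ A₁ =>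
    (s.fst, s.snd, s.phase, s.armed, s.resets, s.trigger, s.toggle)) ?_
  rintro ⟨⟩ ⟨⟩ h
  simpa using h

instance : Nonempty (State A₀ A₁) := by
  obtain ⟨a⟩ := A₀.nonempty_state
  obtain ⟨b⟩ := A₁.nonempty_state
  exact ⟨⟨a, b, fun _ => 0, ∅, ∅, ∅, false⟩⟩

variable {A₀ A₁}

abbrev beaconTimer (j : Option Bool) : Timer A₀ A₁ := Sum.inr (Sum.inr (Sum.inl j))

abbrev acceptorTimer (i : Bool) (κ : Fin 4) : Timer A₀ A₁ := Sum.inr (Sum.inr (Sum.inr (i, κ)))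

/-- The length of each timer. -/
def timerLen (P : ResyncParams) : Timer A₀ A₁ → ℝ
  | Sum.inl k => A₀.len k
  | Sum.inr (Sum.inl k) => A₁.len k
  | Sum.inr (Sum.inr (Sum.inl _)) => 6 * P.d
  | Sum.inr (Sum.inr (Sum.inr (i, κ))) => ![30 * P.d, P.lo i, P.hi i, 2 * P.hi i] κ

theorem timerLen_nonneg (P : ResyncParams) (τ : Timer A₀ A₁) : 0 ≤ timerLen P τ := by
  rcases τ with k | k | j | ⟨i, κ⟩
  · exact A₀.len_nonneg k
  · exact A₁.len_nonneg k
  · have := P.d_pos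
    simp only [timerLen]
    positivity
  · have := P.d_pos
    have := P.lo_pos i
    have := P.hi_pos i
    fin_cases κ <;> simp [timerLen] <;> positivity

variable (A₀ A₁)

noncomputable def timerEquiv : Timer A₀ A₁ ≃ Fin (Fintype.card (Timer A₀ A₁)) :=
  Fintype.equivFin _

abbrev streams : ℕ := max A₀.streams A₁.streams + 1

abbrev Message : Type := Fin (streams A₀ A₁) → Symbol A₀ A₁

variable {A₀ A₁}

/-- The phases of the beacons of the sender of a message. -/
def phases (m : Message A₀ A₁) : Option Bool → Fin 3 :=
  match m (Fin.last _) with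
  | Sum.inr p => p
  | Sum.inl _ => fun _ => 0

def symFst : Symbol A₀ A₁ → Option A₀.Sym
  | Sum.inl (Sum.inl a) => some a
  | _ => none

def symSnd : Symbol A₀ A₁ → Option A₁.Sym
  | Sum.inl (Sum.inr a) => some a
  | _ => none

/-- The message of the first algorithm contained in a message from `v` to `u`. -/
noncomputable def decodeFst (u v : W₀) (m : Message A₀ A₁) : A₀.Msg := fun c =>
  -- Only faulty senders produce symbols of the wrong kind, and these may be read as any legal
  -- message, such as the one sent in an arbitrary state.
  (symFst (m (Fin.castSucc (Fin.castLE (le_max_left _ _) c)))).getD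
    (A₀.send v u (Classical.choice A₀.nonempty_state) c)

noncomputable def decodeSnd (u v : W₁) (m : Message A₀ A₁) : A₁.Msg := fun c =>
  (symSnd (m (Fin.castSucc (Fin.castLE (le_max_right _ _) c)))).getD
    (A₁.send v u (Classical.choice A₁.nonempty_state) c)

/-- The stream `c` of the message from `v` to `u`, apart from the stream for the beacons. -/
def blockSend : W₀ ⊕ W₁ → W₀ ⊕ W₁ → State A₀ A₁ → Fin (max A₀.streams A₁.streams) → Symbol A₀ A₁
  | Sum.inl v, Sum.inl u, s, c =>
    if h : (c : ℕ) < A₀.streams then Sum.inl (Sum.inl (A₀.send v u s.fst ⟨c, h⟩))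
    else Sum.inr fun _ => 0
  | Sum.inr v, Sum.inr u, s, c =>
    if h : (c : ℕ) < A₁.streams then Sum.inl (Sum.inr (A₁.send v u s.snd ⟨c, h⟩))
    else Sum.inr fun _ => 0
  | _, _, _, _ => Sum.inr fun _ => 0

def send (v u : W₀ ⊕ W₁) (s : State A₀ A₁) : Message A₀ A₁ :=
  Fin.lastCases (Sum.inr s.phase) (blockSend v u s)

theorem phases_send (v u : W₀ ⊕ W₁) (s : State A₀ A₁) : phases (send v u s) = s.phase := by
  simp [phases, send]

noncomputable def nextFst (v : W₀ ⊕ W₁) (s : State A₀ A₁) (m : W₀ ⊕ W₁ → Message A₀ A₁)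
    (X : Set (Timer A₀ A₁)) : A₀.State :=
  match v with
  | Sum.inl w => A₀.step w s.fst (fun w' => decodeFst w w' (m (Sum.inl w'))) {k | Sum.inl k ∈ X}
  | Sum.inr _ => s.fst

noncomputable def nextSnd (v : W₀ ⊕ W₁) (s : State A₀ A₁) (m : W₀ ⊕ W₁ → Message A₀ A₁)
    (X : Set (Timer A₀ A₁)) : A₁.State :=
  match v with
  | Sum.inl _ => s.snd
  | Sum.inr w => A₁.step w s.snd (fun w' => decodeSnd w w' (m (Sum.inr w')))
      {k | Sum.inr (Sum.inl k) ∈ X}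

/-- The node `v` generates a pulse of the algorithm of its block. -/
def Pulses (v : W₀ ⊕ W₁) (s : State A₀ A₁) (m : W₀ ⊕ W₁ → Message A₀ A₁)
    (X : Set (Timer A₀ A₁)) : Prop :=
  match v with
  | Sum.inl _ => nextFst v s m X ≠ s.fst ∧ nextFst v s m X ∈ A₀.pulse
  | Sum.inr _ => nextSnd v s m X ≠ s.snd ∧ nextSnd v s m X ∈ A₁.pulse

section

variable [Fintype W₀] [Fintype W₁]

/-- The nodes of each block. -/
def block (W₀ W₁ : Type) [Fintype W₀] [Fintype W₁] (i : Bool) : Finset (W₀ ⊕ W₁) :=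
  Finset.univ.filter fun v => v.isRight = i

variable (P : ResyncParams)

/-- The thresholds: votes on a block within its fault bound rest on a correct member of that block,
support rests on a correct voter, and acceptance is always possible with the votes of the correct
nodes alone. -/
def Votes (m : W₀ ⊕ W₁ → Message A₀ A₁) (i : Bool) : Prop :=
  P.blockFaults i < ((block W₀ W₁ i).filter fun u => phases (m u) none = 1).card

def Support (m : W₀ ⊕ W₁ → Message A₀ A₁) (i : Bool) : Prop :=
  P.faults < (Finset.univ.filter fun u => phases (m u) (some i) ≠ 0).card

def Accept (m : W₀ ⊕ W₁ → Message A₀ A₁) (i : Bool) : Prop :=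
  Fintype.card (W₀ ⊕ W₁) ≤
    (Finset.univ.filter fun u => phases (m u) (some i) = 1).card + P.faults

/-- The input of each beacon. -/
def BeaconInput (v : W₀ ⊕ W₁) (s : State A₀ A₁) (m : W₀ ⊕ W₁ → Message A₀ A₁)
    (X : Set (Timer A₀ A₁)) : Option Bool → Prop
  | none => Pulses v s m X
  | some i => Votes P m i

noncomputable def nextPhase (v : W₀ ⊕ W₁) (s : State A₀ A₁) (m : W₀ ⊕ W₁ → Message A₀ A₁)
    (X : Set (Timer A₀ A₁)) (j : Option Bool) : Fin 3 :=
  beaconStep (s.phase j) (BeaconInput P v s m X j) (beaconTimer j ∈ X)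

def Event (m : W₀ ⊕ W₁ → Message A₀ A₁) (X : Set (Timer A₀ A₁)) (i : Bool) : Prop :=
  acceptorTimer i 0 ∈ X ∧ Support P m i

/-- Either a good event starts in this very update, or the acceptor is still armed and the window of
the earlier event is still open. -/
def Candidate (s : State A₀ A₁) (m : W₀ ⊕ W₁ → Message A₀ A₁) (X : Set (Timer A₀ A₁))
    (i : Bool) : Prop :=
  (Event P m X i ∧ (acceptorTimer i 1 ∈ X ∧ acceptorTimer i 2 ∉ X) ∧ acceptorTimer i 3 ∈ X) ∨
    (¬ Event P m X i ∧ i ∈ s.armed ∧ acceptorTimer i 0 ∉ X)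

/-- The timers that are reset in an update. -/
def Resets (v : W₀ ⊕ W₁) (s : State A₀ A₁) (m : W₀ ⊕ W₁ → Message A₀ A₁)
    (X : Set (Timer A₀ A₁)) : Timer A₀ A₁ → Prop
  | Sum.inl k => nextFst v s m X ≠ s.fst ∧ nextFst v s m X ∈ A₀.resetOn k
  | Sum.inr (Sum.inl k) => nextSnd v s m X ≠ s.snd ∧ nextSnd v s m X ∈ A₁.resetOn k
  | Sum.inr (Sum.inr (Sum.inl j)) => nextPhase P v s m X j ≠ s.phase j
  | Sum.inr (Sum.inr (Sum.inr (i, κ))) => Event P m X i ∧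
      (κ = 3 → ¬ (acceptorTimer i 1 ∈ X ∧ acceptorTimer i 2 ∉ X))

noncomputable def next (v : W₀ ⊕ W₁) (s : State A₀ A₁) (m : W₀ ⊕ W₁ → Message A₀ A₁)
    (X : Set (Timer A₀ A₁)) : State A₀ A₁ where
  fst := nextFst v s m X
  snd := nextSnd v s m X
  phase := nextPhase P v s m X
  armed := {i | Candidate P s m X i ∧ ¬ Accept P m i}
  resets := {τ | Resets P v s m X τ}
  trigger := {i | Candidate P s m X i ∧ Accept P m i}
  toggle := !s.toggle

end

end Resync

open Resync in
/-- The nodes of each block run a pulse synchronisation algorithm. All nodes vote on the pulses of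
each block, and generate a pulse when they accept the votes on one of the blocks. -/
noncomputable def resyncAlgorithm {W₀ W₁ : Type} [Fintype W₀] [Fintype W₁] (P : ResyncParams)
    (A₀ : Algorithm W₀) (A₁ : Algorithm W₁) : Algorithm (W₀ ⊕ W₁) where
  State := Resync.State A₀ A₁
  finite_state := inferInstance
  nonempty_state := inferInstance
  pulse := {s | s.trigger.Nonempty}
  streams := streams A₀ A₁
  Sym := Symbol A₀ A₁
  finite_sym := by
    have := A₀.finite_sym
    have := A₁.finite_sym
    infer_instance
  timers := Fintype.card (Timer A₀ A₁)
  len k := timerLen P ((timerEquiv A₀ A₁).symm k)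
  len_nonneg k := timerLen_nonneg P _
  resetOn k := {s | (timerEquiv A₀ A₁).symm k ∈ s.resets}
  step v s m X := next P v s m {τ | timerEquiv A₀ A₁ τ ∈ X}
  send := send

/-! ### Executions of the resynchronisation algorithm as instances of beacons, acceptors and voting
-/

namespace Resync

variable {W₀ W₁ : Type} [Fintype W₀] [Fintype W₁] (P : ResyncParams)
  (A₀ : Algorithm W₀) (A₁ : Algorithm W₁)

/-- The toggle bit makes each update a change of state, so that the recorded resets and triggers
take effect even if they repeat those of the previous update. Messages do not depend on the bit. -/
theorem step_ne (v : W₀ ⊕ W₁) (s : State A₀ A₁) (m : W₀ ⊕ W₁ → Message A₀ A₁)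
    (X : Set (Fin (Fintype.card (Timer A₀ A₁)))) :
    (resyncAlgorithm P A₀ A₁).step v s m X ≠ s := fun h => by
  have : (!s.toggle) = s.toggle := congrArg State.toggle h
  simp at this

noncomputable def simulationFst : Simulation A₀ (resyncAlgorithm P A₀ A₁) where
  ι := Sum.inl
  proj := State.fst
  timer k := timerEquiv A₀ A₁ (Sum.inl k)
  decode := decodeFst
  len_timer k := by simp [resyncAlgorithm, timerLen]
  decode_send u v s := by
    funext c
    have hc : blockSend (Sum.inl v) (Sum.inl u) s (Fin.castLE (le_max_left _ A₁.streams) c) =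
        Sum.inl (Sum.inl (A₀.send v u s.fst c)) := by
      simp [blockSend]
    simp only [decodeFst, resyncAlgorithm, send, Fin.lastCases_castSucc]
    rw [hc]
    rfl
  proj_step v s m X := rfl
  step_mem_resetOn v s m X k := by
    simp only [resyncAlgorithm, next, Equiv.symm_apply_apply]
    rfl
  step_ne := step_ne P A₀ A₁

noncomputable def simulationSnd : Simulation A₁ (resyncAlgorithm P A₀ A₁) where
  ι := Sum.inr
  proj := State.snd
  timer k := timerEquiv A₀ A₁ (Sum.inr (Sum.inl k))
  decode := decodeSnd
  len_timer k := by simp [resyncAlgorithm, timerLen]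
  decode_send u v s := by
    funext c
    have hc : blockSend (Sum.inr v) (Sum.inr u) s (Fin.castLE (le_max_right A₀.streams _) c) =
        Sum.inl (Sum.inr (A₁.send v u s.snd c)) := by
      simp [blockSend]
    simp only [decodeSnd, resyncAlgorithm, send, Fin.lastCases_castSucc]
    rw [hc]
    rfl
  proj_step v s m X := rfl
  step_mem_resetOn v s m X k := by
    simp only [resyncAlgorithm, next, Equiv.symm_apply_apply]
    rfl
  step_ne := step_ne P A₀ A₁

variable {P A₀ A₁} {x : Run (resyncAlgorithm P A₀ A₁)} {ϑ : ℝ} {F : Finset (W₀ ⊕ W₁)}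
  {v : W₀ ⊕ W₁}

/-- The state of `v` at time `t`. -/
def st (x : Run (resyncAlgorithm P A₀ A₁)) (v : W₀ ⊕ W₁) (t : ℝ) : State A₀ A₁ := x.state v t

/-- The messages that `v` has most recently received at time `t`. -/
def msg (x : Run (resyncAlgorithm P A₀ A₁)) (v : W₀ ⊕ W₁) (t : ℝ) (u : W₀ ⊕ W₁) :
    Message A₀ A₁ := x.inbox v t u

/-- The timers of `v` that have expired at time `t`. -/
def expired (x : Run (resyncAlgorithm P A₀ A₁)) (v : W₀ ⊕ W₁) (t : ℝ) : Set (Timer A₀ A₁) :=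
  {τ | x.Expired v (timerEquiv A₀ A₁ τ) t}

theorem st_step (hx : x.IsExecution P.d ϑ F) (hv : v ∉ F) {r u : ℝ} (hu : u ∈ x.updates v)
    (hg : Gap (x.updates v) r u) :
    st x v u = next P v (st x v r) (msg x v u) (expired x v u) :=
  (hx.isTrace hv).step r u hu hg

theorem st_keep (hx : x.IsExecution P.d ϑ F) (hv : v ∉ F) {r t : ℝ} (hr : 0 ≤ r) (hrt : r ≤ t)
    (hno : ∀ u ∈ x.updates v, u ∉ Ioc r t) : st x v t = st x v r :=
  (hx.isTrace hv).keep r t hr hrt hno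

theorem msg_keep (hx : x.IsExecution P.d ϑ F) (hv : v ∉ F) {r t : ℝ} (hr : 0 ≤ r) (hrt : r ≤ t)
    (hno : ∀ u ∈ x.updates v, u ∉ Ioc r t) : msg x v t = msg x v r :=
  hx.inbox_keep hv r t hr hrt hno

theorem isLevel_msg (hx : x.IsExecution P.d ϑ F) (hv : v ∉ F)
    (p : (W₀ ⊕ W₁ → Message A₀ A₁) → Prop) : IsLevel (x.updates v) {t | p (msg x v t)} :=
  fun r t hr hrt hno => by
    simp only [mem_ofPred_eq]
    rw [msg_keep hx hv hr hrt hno]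

theorem isTimer (hx : x.IsExecution P.d ϑ F) (hϑ : ϑ ≤ 1.004) (hv : v ∉ F) (τ : Timer A₀ A₁)
    (hτ : 0 < timerLen P τ) : IsTimer (x.updates v) (x.clock v) P.d (timerLen P τ)
      {t | t ∈ x.updates v ∧ τ ∈ (st x v t).resets} {t | τ ∈ expired x v t} := by
  have hlen : (resyncAlgorithm P A₀ A₁).len (timerEquiv A₀ A₁ τ) = timerLen P τ := by
    simp [resyncAlgorithm]
  have h := hx.isTimer (hx.isClock hϑ v) hv (timerEquiv A₀ A₁ τ) (by rwa [hlen]) P.d_pos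
  rw [hlen] at h
  have hR : {t | x.Resets v (timerEquiv A₀ A₁ τ) t} =
      {t | t ∈ x.updates v ∧ τ ∈ (st x v t).resets} := by
    ext t
    change ChangesAt (x.state v) t ∧ (timerEquiv A₀ A₁).symm (timerEquiv A₀ A₁ τ) ∈
      (st x v t).resets ↔ _
    rw [hx.changesAt_iff_of_step_ne hv (step_ne P A₀ A₁ v), Equiv.symm_apply_apply]
    rfl
  rw [hR] at h
  exact h

theorem resets_iff (hx : x.IsExecution P.d ϑ F) (hv : v ∉ F) {r u : ℝ} (hu : u ∈ x.updates v)
    (hg : Gap (x.updates v) r u) (τ : Timer A₀ A₁) :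
    τ ∈ (st x v u).resets ↔ Resets P v (st x v r) (msg x v u) (expired x v u) τ := by
  rw [st_step hx hv hu hg]
  rfl

theorem isBeacon (hx : x.IsExecution P.d ϑ F) (hϑ : ϑ ≤ 1.004) (hv : v ∉ F) (j : Option Bool)
    (inp : Set ℝ) (hinp : ∀ r u, u ∈ x.updates v → Gap (x.updates v) r u →
      (u ∈ inp ↔ BeaconInput P v (st x v r) (msg x v u) (expired x v u) j)) :
    IsBeacon (x.updates v) (x.clock v) P.d (fun t => (st x v t).phase j) inp
      {t | t ∈ x.updates v ∧ beaconTimer j ∈ (st x v t).resets}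
      {t | beaconTimer j ∈ expired x v t} where
  schedule := hx.isSchedule hv
  clock := hx.isClock hϑ v
  timer := isTimer hx hϑ hv (beaconTimer j) (by have := P.d_pos; simp [timerLen, this])
  trace := by
    refine ⟨fun r t hr hrt hno => by rw [st_keep hx hv hr hrt hno], fun r u hu hg => ?_⟩
    simp only [hinp r u hu hg]
    rw [st_step hx hv hu hg]
    rfl
  mem_reset r u hu hg := by
    have h1 : (st x v u).phase j =
        nextPhase P v (st x v r) (msg x v u) (expired x v u) j := by
      rw [st_step hx hv hu hg]
      rfl
    simp only [mem_ofPred_eq, hu, true_and]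
    rw [resets_iff hx hv hu hg, h1]
    rfl
  reset_subset _ h := h.1

theorem isAcceptor (hx : x.IsExecution P.d ϑ F) (hϑ : ϑ ≤ 1.004) (hv : v ∉ F) (i : Bool) :
    IsAcceptor (x.updates v) (x.clock v) P.d (P.lo i) (P.hi i)
      {t | Support P (msg x v t) i} {t | Accept P (msg x v t) i} {t | i ∈ (st x v t).armed}
      {t | t ∈ x.updates v ∧ acceptorTimer i 0 ∈ (st x v t).resets}
      {t | t ∈ x.updates v ∧ i ∈ (st x v t).trigger}
      {t | acceptorTimer i 0 ∈ expired x v t} {t | acceptorTimer i 1 ∈ expired x v t}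
      {t | acceptorTimer i 2 ∈ expired x v t} {t | acceptorTimer i 3 ∈ expired x v t} := by
  have hd := P.d_pos
  have hlo := P.lo_pos i
  have hhi := P.hi_pos i
  have hgap : ∀ {u}, u ∈ x.updates v → ∃ r, Gap (x.updates v) r u := fun {u} hu => by
    obtain ⟨r, -, hg⟩ := (hx.isSchedule hv).exists_gap le_rfl (hx.updates_pos v hv u hu)
    exact ⟨r, hg⟩
  have hE : ∀ {u} (κ : Fin 4), u ∈ x.updates v → (acceptorTimer i κ ∈ (st x v u).resets ↔
      Event P (msg x v u) (expired x v u) i ∧ (κ = 3 → ¬ (acceptorTimer i 1 ∈ expired x v u ∧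
        acceptorTimer i 2 ∉ expired x v u))) := fun {u} κ hu => by
    obtain ⟨r, hg⟩ := hgap hu
    rw [resets_iff hx hv hu hg]
    rfl
  have hE0 : ∀ {u}, u ∈ x.updates v → (acceptorTimer i 0 ∈ (st x v u).resets ↔
      Event P (msg x v u) (expired x v u) i) := fun {u} hu => by
    rw [hE 0 hu]
    simp
  -- All acceptor timers but the blocking one are reset at every event.
  have hsame : ∀ κ : Fin 4, κ ≠ 3 → {t | t ∈ x.updates v ∧ acceptorTimer i κ ∈ (st x v t).resets} =
      {t | t ∈ x.updates v ∧ acceptorTimer i 0 ∈ (st x v t).resets} := fun κ hκ => by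
    ext t
    refine and_congr_right fun ht => ?_
    rw [hE0 ht, hE κ ht]
    simp [hκ]
  refine
    { schedule := hx.isSchedule hv
      clock := hx.isClock hϑ v
      timer_window := ?_
      timer_min := ?_
      timer_max := ?_
      timer_block := ?_
      level_support := isLevel_msg hx hv fun m => Support P m i
      level_accept := isLevel_msg hx hv fun m => Accept P m i
      level_armed := fun r t hr hrt hno => by
        simp only [mem_ofPred_eq]
        rw [st_keep hx hv hr hrt hno]
      mem_event := fun u => and_congr_right fun hu => hE0 hu
      trigger_subset := fun _ h => h.1
      mem_armed := fun r u hu hg => ?_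
      mem_trigger := fun r u hu hg => ?_ }
  · exact isTimer hx hϑ hv (acceptorTimer i 0) (by simp [timerLen, hd])
  · rw [← hsame 1 (by decide)]
    exact isTimer hx hϑ hv (acceptorTimer i 1) (by simp [timerLen, hlo])
  · rw [← hsame 2 (by decide)]
    exact isTimer hx hϑ hv (acceptorTimer i 2) (by simp [timerLen, hhi])
  · have h := isTimer hx hϑ hv (acceptorTimer i 3) (by simp [timerLen, hhi])
    have hR : {t | t ∈ x.updates v ∧ acceptorTimer i 3 ∈ (st x v t).resets} =
        {t | t ∈ x.updates v ∧ acceptorTimer i 0 ∈ (st x v t).resets} \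
          ({t | acceptorTimer i 1 ∈ expired x v t} \ {t | acceptorTimer i 2 ∈ expired x v t}) := by
      ext t
      simp only [Set.mem_sdiff, mem_ofPred_eq, and_assoc]
      refine and_congr_right fun ht => ?_
      rw [hE0 ht, hE 3 ht]
      simp
    rw [hR] at h
    exact h
  · simp only [mem_ofPred_eq, hu, true_and, hE0 hu, mem_inter_iff, Set.mem_sdiff]
    rw [st_step hx hv hu hg]
    rfl
  · simp only [mem_ofPred_eq, hu, true_and, hE0 hu, mem_inter_iff, Set.mem_sdiff]
    rw [st_step hx hv hu hg]
    rfl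

/-- The pulses of the algorithm that is run by the block of `v`. -/
def blockPulses (x : Run (resyncAlgorithm P A₀ A₁)) : W₀ ⊕ W₁ → Set ℝ
  | Sum.inl w => (x.restrict (simulationFst P A₀ A₁)).pulses w
  | Sum.inr w => (x.restrict (simulationSnd P A₀ A₁)).pulses w

theorem blockPulses_subset (hx : x.IsExecution P.d ϑ F) (hv : v ∉ F) :
    blockPulses x v ⊆ x.updates v := by
  rcases v with w | w
  · exact fun t ht => hx.mem_updates_of_changesAt hv (ChangesAt.of_comp (φ := State.fst) ht.1)
  · exact fun t ht => hx.mem_updates_of_changesAt hv (ChangesAt.of_comp (φ := State.snd) ht.1)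

theorem mem_blockPulses (hx : x.IsExecution P.d ϑ F) (hv : v ∉ F) {r u : ℝ}
    (hu : u ∈ x.updates v) (hg : Gap (x.updates v) r u) :
    u ∈ blockPulses x v ↔ Pulses v (st x v r) (msg x v u) (expired x v u) := by
  rcases v with w | w
  · have h1 : (st x (Sum.inl w) u).fst = nextFst (Sum.inl w) (st x (Sum.inl w) r)
        (msg x (Sum.inl w) u) (expired x (Sum.inl w) u) := by
      rw [st_step hx hv hu hg]
      rfl
    have h2 := hx.transitionsTo_restrict (simulationFst P A₀ A₁) (w := w) (Q := A₀.pulse) hv hg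
    refine h2.trans ?_
    change (st x (Sum.inl w) u).fst ≠ _ ∧ (st x (Sum.inl w) u).fst ∈ _ ↔ _
    rw [h1]
    rfl
  · have h1 : (st x (Sum.inr w) u).snd = nextSnd (Sum.inr w) (st x (Sum.inr w) r)
        (msg x (Sum.inr w) u) (expired x (Sum.inr w) u) := by
      rw [st_step hx hv hu hg]
      rfl
    have h2 := hx.transitionsTo_restrict (simulationSnd P A₀ A₁) (w := w) (Q := A₁.pulse) hv hg
    refine h2.trans ?_
    change (st x (Sum.inr w) u).snd ≠ _ ∧ (st x (Sum.inr w) u).snd ∈ _ ↔ _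
    rw [h1]
    rfl

theorem isVoting (hx : x.IsExecution P.d ϑ F) (hϑ : ϑ ≤ 1.004) (hF : F.card ≤ P.faults)
    (hcard : 3 * P.faults < Fintype.card (W₀ ⊕ W₁)) (i : Bool) :
    IsVoting F (block W₀ W₁ i) P.faults (P.blockFaults i) P.d (P.lo i) (P.hi i) x.updates x.clock
      (blockPulses x) (fun v t => (st x v t).phase none) (fun v t => (st x v t).phase (some i))
      (fun v t u => phases (msg x v t u) none) (fun v t u => phases (msg x v t u) (some i))
      (fun v => {t | t ∈ x.updates v ∧ acceptorTimer i 0 ∈ (st x v t).resets})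
      (fun v => ({t | acceptorTimer i 1 ∈ expired x v t} \ {t | acceptorTimer i 2 ∈ expired x v t}) ∩
        {t | acceptorTimer i 3 ∈ expired x v t})
      (fun v => {t | t ∈ x.updates v ∧ i ∈ (st x v t).trigger}) where
  card_faulty := hF
  card_lt := hcard
  delay_pos := P.d_pos
  pulse_subset v hv := blockPulses_subset hx hv
  source v _ hv := ⟨_, _, isBeacon hx hϑ hv none _ fun r u hu hg => mem_blockPulses hx hv hu hg⟩
  voter v hv := ⟨_, _, isBeacon hx hϑ hv (some i) _ fun r u _ _ => Iff.rfl⟩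
  level_source v hv := isLevel_msg hx hv fun m => Votes P m i
  acceptor v hv := ⟨_, _, _, _, _, rfl, isAcceptor hx hϑ hv i⟩
  received v hv u hu t ht := by
    obtain ⟨s, h0, h1, h2, hs⟩ := hx.exists_received hv hu ht (P.d_pos.le.trans ht)
    have hs' : msg x v t u = send u v (st x u s) := hs
    exact ⟨s, h0, h1, h2, by rw [hs', phases_send], by rw [hs', phases_send]⟩

theorem mem_pulses (hx : x.IsExecution P.d ϑ F) (hv : v ∉ F) {t : ℝ} :
    t ∈ x.pulses v ↔ ∃ i, t ∈ x.updates v ∧ i ∈ (st x v t).trigger := by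
  change ChangesAt (x.state v) t ∧ (st x v t).trigger.Nonempty ↔ _
  rw [hx.changesAt_iff_of_step_ne hv (step_ne P A₀ A₁ v), exists_and_left]
  rfl

end Resync

/-! ### Communication -/

theorem exists_changesAt_apply {ι α : Type} [Finite ι] {g : ℝ → ι → α} {t : ℝ}
    (h : ChangesAt g t) : ∃ i, ChangesAt (fun t => g t i) t := by
  by_contra hc
  refine h.2 ?_
  have : ∀ i, JustBefore (fun t => g t i) t (g t i) := fun i => by
    by_contra hi
    exact hc ⟨i, h.1, hi⟩
  filter_upwards [eventually_all.2 this] with s hs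
  exact funext hs

theorem Fin.sum_dite_lt {k M : ℕ} (hk : k ≤ M) (g : Fin k → ℕ∞) :
    ∑ c : Fin M, (if h : (c : ℕ) < k then g ⟨c, h⟩ else 0) = ∑ c, g c := by
  obtain ⟨m, rfl⟩ := Nat.exists_eq_add_of_le hk
  rw [Fin.sum_univ_add]
  simp

namespace Resync

/-- Three beacons have `3 ^ 3 = 27 ≤ 2 ^ 5` joint phases. -/
theorem clog_beacon_le {W₀ W₁ : Type} (A₀ : Algorithm W₀) (A₁ : Algorithm W₁) :
    Nat.clog 2 (range fun s : State A₀ A₁ => (Sum.inr s.phase : Symbol A₀ A₁)).ncard ≤ 5 := by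
  have hsub : (range fun s : State A₀ A₁ => (Sum.inr s.phase : Symbol A₀ A₁)) ⊆
      (Sum.inr : (Option Bool → Fin 3) → Symbol A₀ A₁) '' univ := by
    rintro _ ⟨s, rfl⟩
    exact mem_image_of_mem _ (mem_univ _)
  have h1 := ncard_le_ncard hsub (toFinite _)
  have h2 : ((Sum.inr : (Option Bool → Fin 3) → Symbol A₀ A₁) '' univ).ncard ≤ 27 := by
    rw [ncard_image_of_injective _ Sum.inr_injective, ncard_univ, Nat.card_eq_fintype_card]
    simp
  exact Nat.clog_le_of_le_pow (show _ ≤ 2 ^ 5 by omega)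

variable {W₀ W₁ : Type} [Fintype W₀] [Fintype W₁] {P : ResyncParams}
  {A₀ : Algorithm W₀} {A₁ : Algorithm W₁} {x : Run (resyncAlgorithm P A₀ A₁)} {ϑ : ℝ}
  {F : Finset (W₀ ⊕ W₁)} {v : W₀ ⊕ W₁}

theorem exists_isBeacon (hx : x.IsExecution P.d ϑ F) (hϑ : ϑ ≤ 1.004) (hv : v ∉ F)
    (j : Option Bool) : ∃ inp, IsBeacon (x.updates v) (x.clock v) P.d
      (fun t => (st x v t).phase j) inp
      {t | t ∈ x.updates v ∧ beaconTimer j ∈ (st x v t).resets}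
      {t | beaconTimer j ∈ expired x v t} := by
  cases j with
  | none => exact ⟨_, isBeacon hx hϑ hv none _ fun r u hu hg => mem_blockPulses hx hv hu hg⟩
  | some i =>
    exact ⟨{t | Votes P (msg x v t) i}, isBeacon hx hϑ hv (some i) _ fun r u _ _ => Iff.rfl⟩

/-- Each change of phase resets the timer of the beacon, and these resets are more than `5 * d`
apart from the start of the execution on. -/
theorem encard_phase_changes_le (hx : x.IsExecution P.d ϑ F) (hϑ : ϑ ≤ 1.004) (hv : v ∉ F)
    (j : Option Bool) (a : ℝ) :
    {t | t ∈ Ico a (a + P.d) ∧ ChangesAt (fun t => (st x v t).phase j) t}.encard ≤ 1 := by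
  have hd := P.d_pos
  obtain ⟨inp, h⟩ := exists_isBeacon hx hϑ hv j
  have hR : ∀ {t}, ChangesAt (fun t => (st x v t).phase j) t →
      t ∈ {t | t ∈ x.updates v ∧ beaconTimer j ∈ (st x v t).resets} := fun {t} ht => by
    have hst : ChangesAt (st x v) t := ChangesAt.of_comp (φ := fun s => s.phase j) ht
    obtain ⟨r, -, hg⟩ := h.schedule.exists_gap le_rfl ht.1
    refine (h.mem_reset r t (hx.mem_updates_of_changesAt hv hst) hg).2 fun he => ht.2 ?_
    have := (hx.justBefore_of_gap hv hg).comp fun s : State A₀ A₁ => s.phase j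
    change JustBefore _ t ((st x v t).phase j)
    simp only [he]
    exact this
  refine encard_le_one_iff.2 fun s t hs ht => ?_
  rcases lt_trichotomy s t with hst | hst | hst
  · linarith [h.reset_separated hd (hR hs.2) (hR ht.2) hst, hs.1.1, ht.1.2]
  · exact hst
  · linarith [h.reset_separated hd (hR ht.2) (hR hs.2) hst, ht.1.1, hs.1.2]

theorem encard_beacon_changes_le (hx : x.IsExecution P.d ϑ F) (hϑ : ϑ ≤ 1.004) (hv : v ∉ F)
    (a : ℝ) : {t | t ∈ Ico a (a + P.d) ∧
      ChangesAt (fun t => (Sum.inr (st x v t).phase : Symbol A₀ A₁)) t}.encard ≤ 3 := by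
  set S : Option Bool → Set ℝ := fun j =>
    {t | t ∈ Ico a (a + P.d) ∧ ChangesAt (fun t => (st x v t).phase j) t}
  have hsub : {t | t ∈ Ico a (a + P.d) ∧
      ChangesAt (fun t => (Sum.inr (st x v t).phase : Symbol A₀ A₁)) t} ⊆
      (S none ∪ S (some false)) ∪ S (some true) := by
    rintro t ⟨htI, ht⟩
    obtain ⟨j, hj⟩ := exists_changesAt_apply
      (ChangesAt.of_comp (φ := (Sum.inr : _ → Symbol A₀ A₁)) (g := fun t => (st x v t).phase) ht)
    match j with
    | none => exact Or.inl (Or.inl ⟨htI, hj⟩)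
    | some false => exact Or.inl (Or.inr ⟨htI, hj⟩)
    | some true => exact Or.inr ⟨htI, hj⟩
  have h1 := fun j => encard_phase_changes_le hx hϑ hv j a
  refine (encard_le_encard hsub).trans ((encard_union_le _ _).trans ?_)
  refine (add_le_add ((encard_union_le _ _).trans (add_le_add (h1 _) (h1 _))) (h1 _)).trans ?_
  norm_num

theorem bits_eq (x : Run (resyncAlgorithm P A₀ A₁)) (u v : W₀ ⊕ W₁) (a b : ℝ) :
    x.bits u v a b = (∑ c : Fin (max A₀.streams A₁.streams),
      (Nat.clog 2 (range fun s : State A₀ A₁ => blockSend u v s c).ncard : ℕ∞) *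
        {t | t ∈ Ico a b ∧ ChangesAt (fun t => blockSend u v (st x u t) c) t}.encard) +
      (Nat.clog 2 (range fun s : State A₀ A₁ => (Sum.inr s.phase : Symbol A₀ A₁)).ncard : ℕ∞) *
        {t | t ∈ Ico a b ∧
          ChangesAt (fun t => (Sum.inr (st x u t).phase : Symbol A₀ A₁)) t}.encard := by
  have h1 : ∀ s : State A₀ A₁, send u v s (Fin.last _) = Sum.inr s.phase := fun s => by simp [send]
  have h2 : ∀ (s : State A₀ A₁) c, send u v s (Fin.castSucc c) = blockSend u v s c :=
    fun s c => by simp [send]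
  refine (Fin.sum_univ_castSucc (n := max A₀.streams A₁.streams) _).trans ?_
  change (∑ c : Fin (max A₀.streams A₁.streams),
      (Nat.clog 2 (range fun s : State A₀ A₁ => send u v s (Fin.castSucc c)).ncard : ℕ∞) *
        {t | t ∈ Ico a b ∧ ChangesAt (fun t => send u v (st x u t) (Fin.castSucc c)) t}.encard) +
      (Nat.clog 2 (range fun s : State A₀ A₁ => send u v s (Fin.last _)).ncard : ℕ∞) *
        {t | t ∈ Ico a b ∧ ChangesAt (fun t => send u v (st x u t) (Fin.last _)) t}.encard = _
  simp only [h1, h2]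

/-- Inner symbols are embedded injectively, and every inner state occurs in an outer state, so the
alphabet sizes and the times of change agree stream by stream. Padding streams are constant and
free. -/
theorem bits_block_fst (x : Run (resyncAlgorithm P A₀ A₁)) (u v : W₀) (a b : ℝ) :
    ∑ c : Fin (max A₀.streams A₁.streams),
      (Nat.clog 2 (range fun s : State A₀ A₁ =>
        blockSend (Sum.inl u) (Sum.inl v) s c).ncard : ℕ∞) *
        {t | t ∈ Ico a b ∧ ChangesAt (fun t =>
          blockSend (Sum.inl u) (Sum.inl v) (st x (Sum.inl u) t) c) t}.encard =
      (x.restrict (simulationFst P A₀ A₁)).bits u v a b := by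
  unfold Run.bits
  rw [← Fin.sum_dite_lt (le_max_left A₀.streams A₁.streams)]
  refine Finset.sum_congr rfl fun c _ => ?_
  by_cases h : (c : ℕ) < A₀.streams
  · have hinj : Function.Injective fun a : A₀.Sym => (Sum.inl (Sum.inl a) : Symbol A₀ A₁) :=
      Sum.inl_injective.comp Sum.inl_injective
    have hsurj : Function.Surjective (State.fst : State A₀ A₁ → A₀.State) := fun s => by
      obtain ⟨s'⟩ := (inferInstance : Nonempty (State A₀ A₁))
      exact ⟨{ s' with fst := s }, rfl⟩
    have hr : (range fun s : State A₀ A₁ =>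
        (Sum.inl (Sum.inl (A₀.send u v s.fst ⟨c, h⟩)) : Symbol A₀ A₁)) =
        (fun a => Sum.inl (Sum.inl a)) '' range fun s => A₀.send u v s ⟨c, h⟩ := by
      rw [← range_comp, ← hsurj.range_comp]
      rfl
    simp only [blockSend, dif_pos h]
    rw [hr, ncard_image_of_injective _ hinj]
    have hch : ∀ t, ChangesAt (fun t =>
        (Sum.inl (Sum.inl (A₀.send u v (st x (Sum.inl u) t).fst ⟨c, h⟩)) : Symbol A₀ A₁)) t ↔
        ChangesAt (fun t => A₀.send u v
          ((x.restrict (simulationFst P A₀ A₁)).state u t) ⟨c, h⟩) t := fun t =>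
      ChangesAt.comp_injective (g := fun t => A₀.send u v (st x (Sum.inl u) t).fst ⟨c, h⟩) hinj
    simp only [hch]
  · simp only [blockSend, dif_neg h, not_changesAt_const, and_false]
    simp

theorem bits_block_snd (x : Run (resyncAlgorithm P A₀ A₁)) (u v : W₁) (a b : ℝ) :
    ∑ c : Fin (max A₀.streams A₁.streams),
      (Nat.clog 2 (range fun s : State A₀ A₁ =>
        blockSend (Sum.inr u) (Sum.inr v) s c).ncard : ℕ∞) *
        {t | t ∈ Ico a b ∧ ChangesAt (fun t =>
          blockSend (Sum.inr u) (Sum.inr v) (st x (Sum.inr u) t) c) t}.encard =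
      (x.restrict (simulationSnd P A₀ A₁)).bits u v a b := by
  unfold Run.bits
  rw [← Fin.sum_dite_lt (le_max_right A₀.streams A₁.streams)]
  refine Finset.sum_congr rfl fun c _ => ?_
  by_cases h : (c : ℕ) < A₁.streams
  · have hinj : Function.Injective fun a : A₁.Sym => (Sum.inl (Sum.inr a) : Symbol A₀ A₁) :=
      Sum.inl_injective.comp Sum.inr_injective
    have hsurj : Function.Surjective (State.snd : State A₀ A₁ → A₁.State) := fun s => by
      obtain ⟨s'⟩ := (inferInstance : Nonempty (State A₀ A₁))
      exact ⟨{ s' with snd := s }, rfl⟩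
    have hr : (range fun s : State A₀ A₁ =>
        (Sum.inl (Sum.inr (A₁.send u v s.snd ⟨c, h⟩)) : Symbol A₀ A₁)) =
        (fun a => Sum.inl (Sum.inr a)) '' range fun s => A₁.send u v s ⟨c, h⟩ := by
      rw [← range_comp, ← hsurj.range_comp]
      rfl
    simp only [blockSend, dif_pos h]
    rw [hr, ncard_image_of_injective _ hinj]
    have hch : ∀ t, ChangesAt (fun t =>
        (Sum.inl (Sum.inr (A₁.send u v (st x (Sum.inr u) t).snd ⟨c, h⟩)) : Symbol A₀ A₁)) t ↔
        ChangesAt (fun t => A₁.send u v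
          ((x.restrict (simulationSnd P A₀ A₁)).state u t) ⟨c, h⟩) t := fun t =>
      ChangesAt.comp_injective (g := fun t => A₁.send u v (st x (Sum.inr u) t).snd ⟨c, h⟩) hinj
    simp only [hch]
  · simp only [blockSend, dif_neg h, not_changesAt_const, and_false]
    simp

/-- A channel inside a block costs what the inner algorithm pays in the restricted run, and between
the blocks these streams are constant. The beacon stream adds three changes of 5 bits each. -/
theorem bitRate_le (P : ResyncParams) (A₀ : Algorithm W₀) (A₁ : Algorithm W₁) (hϑ : ϑ ≤ 1.004) :
    (resyncAlgorithm P A₀ A₁).bitRate P.d ϑ ≤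
      max (A₀.bitRate P.d ϑ) (A₁.bitRate P.d ϑ) + (15 : ℕ) := by
  refine sSup_le ?_
  rintro _ ⟨F, x, u, v, t, hx, hu, ht, rfl⟩
  rw [bits_eq]
  refine add_le_add ?_ ?_
  · rcases u with u | u <;> rcases v with v | v
    · rw [bits_block_fst]
      exact le_max_of_le_left (le_sSup ⟨F.toLeft, _, u, v, t,
        hx.restrict (simulationFst P A₀ A₁) fun w => Finset.mem_toLeft,
        mt Finset.mem_toLeft.1 hu, ht, rfl⟩)
    · simp [blockSend, not_changesAt_const]
    · simp [blockSend, not_changesAt_const]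
    · rw [bits_block_snd]
      exact le_max_of_le_right (le_sSup ⟨F.toRight, _, u, v, t,
        hx.restrict (simulationSnd P A₀ A₁) fun w => Finset.mem_toRight,
        mt Finset.mem_toRight.1 hu, ht, rfl⟩)
  · refine (mul_le_mul' (Nat.cast_le.2 (clog_beacon_le A₀ A₁))
      (encard_beacon_changes_le hx hϑ hu t)).trans ?_
    norm_num

end Resync

/-! ### Stabilisation -/

/-- The windows start at the earliest pulse with each index. The minimising node supplied by the
accuracy bound may depend on `v`, but the minimum does not, so one correct node `w₀` is enough to
define `q`. -/
theorem Run.StabilisedFrom.exists_windows {W : Type} {A : Algorithm W} {y : Run A} {F : Finset W}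
    {d T T' t₀ : ℝ} (h : y.StabilisedFrom F (2 * d) T T' t₀) {w₀ : W} (hw₀ : w₀ ∉ F) :
    ∃ q : ℕ → ℝ, t₀ ≤ q 0 ∧ q 0 ≤ t₀ + T' ∧ (∀ k, q k + T ≤ q (k + 1)) ∧
      (∀ k, q (k + 1) ≤ q k + T') ∧
      (∀ v, v ∉ F → ∀ s ∈ y.pulses v, t₀ ≤ s → ∃ k, q k ≤ s ∧ s < q k + 2 * d) ∧
      ∀ v, v ∉ F → ∀ k, ∃ s ∈ y.pulses v, q k ≤ s ∧ s < q k + 2 * d := by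
  obtain ⟨p, hrange, hstart, hskew, hacc⟩ := h
  choose w hwF hwmin hlow hupp using fun k => hacc w₀ hw₀ k
  have hacc' : ∀ v, v ∉ F → ∀ k, p (w k) k + T ≤ p v (k + 1) ∧ p v (k + 1) ≤ p (w k) k + T' := by
    intro v hv k
    obtain ⟨w', hw', hmin', h1, h2⟩ := hacc v hv k
    have := le_antisymm (hwmin k w' hw') (hmin' (w k) (hwF k))
    constructor <;> linarith
  have hmem : ∀ v, v ∉ F → ∀ k, p v k ∈ y.pulses v ∩ Ici t₀ := fun v hv k => by
    rw [← (hrange v hv).2]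
    exact mem_range_self k
  have hclose : ∀ v, v ∉ F → ∀ k, p (w k) k ≤ p v k ∧ p v k < p (w k) k + 2 * d := fun v hv k =>
    ⟨hwmin k v hv, by linarith [(abs_lt.1 (hskew (w k) (hwF k) v hv k)).2]⟩
  refine ⟨fun k => p (w k) k, (hmem _ (hwF 0) 0).2, hstart _ (hwF 0),
    fun k => (hacc' _ (hwF _) k).1, fun k => (hacc' _ (hwF _) k).2, fun v hv s hs hts => ?_,
    fun v hv k => ⟨p v k, (hmem v hv k).1, hclose v hv k⟩⟩
  obtain ⟨k, rfl⟩ : s ∈ range (p v) := by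
    rw [(hrange v hv).2]
    exact ⟨hs, hts⟩
  exact ⟨k, hclose v hv k⟩

namespace Resync

theorem block_false_eq {W₀ W₁ : Type} [Fintype W₀] [Fintype W₁] :
    block W₀ W₁ false = Finset.univ.map ⟨Sum.inl, Sum.inl_injective⟩ := by
  ext v
  rcases v with v | v <;> simp [block]

theorem block_true_eq {W₀ W₁ : Type} [Fintype W₀] [Fintype W₁] :
    block W₀ W₁ true = Finset.univ.map ⟨Sum.inr, Sum.inr_injective⟩ := by
  ext v
  rcases v with v | v <;> simp [block]

variable {W₀ W₁ : Type} [Fintype W₀] [Fintype W₁] [DecidableEq W₀] [DecidableEq W₁]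
  {P : ResyncParams} {A₀ : Algorithm W₀} {A₁ : Algorithm W₁}
  {x : Run (resyncAlgorithm P A₀ A₁)} {ϑ : ℝ} {F : Finset (W₀ ⊕ W₁)}

theorem card_block_false_inter : (block W₀ W₁ false ∩ F).card = F.toLeft.card := by
  have : block W₀ W₁ false ∩ F = F.toLeft.map ⟨Sum.inl, Sum.inl_injective⟩ := by
    ext v
    rcases v with v | v <;> simp [block]
  rw [this, Finset.card_map]

theorem card_block_true_inter : (block W₀ W₁ true ∩ F).card = F.toRight.card := by
  have : block W₀ W₁ true ∩ F = F.toRight.map ⟨Sum.inr, Sum.inr_injective⟩ := by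
    ext v
    rcases v with v | v <;> simp [block]
  rw [this, Finset.card_map]

theorem exists_isPulsing_fst (hx : x.IsExecution P.d ϑ F) {T T' τ : ℝ}
    (hA : A₀.IsPulseSync P.d ϑ (P.blockFaults false) (2 * P.d) T T' τ)
    (hF : F.toLeft.card ≤ P.blockFaults false)
    (hcard : 3 * P.blockFaults false < Fintype.card W₀) (hd : 1000 * P.d ≤ T)
    (hT : T' ≤ 1.05 * T) :
    ∃ t₀ q, t₀ ≤ τ ∧ q 0 ≤ t₀ + T' ∧
      IsPulsing F (block W₀ W₁ false) (P.blockFaults false) P.d T T' t₀ (blockPulses x) q := by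
  obtain ⟨t₀, h0, hτ, hst⟩ := hA F.toLeft hF _
    (hx.restrict (simulationFst P A₀ A₁) fun w => Finset.mem_toLeft)
  obtain ⟨w₀, -, hw₀⟩ := Finset.exists_mem_notMem_of_card_lt_card
    (show F.toLeft.card < (Finset.univ : Finset W₀).card by rw [Finset.card_univ]; omega)
  obtain ⟨q, h1, h2, h3, h4, h5, h6⟩ := hst.exists_windows hw₀
  refine ⟨t₀, q, hτ, h2, ⟨?_, ?_, h0, h1, h3, h4, ?_, ?_, hd, hT⟩⟩
  · rwa [card_block_false_inter]
  · rwa [block_false_eq, Finset.card_map, Finset.card_univ]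
  · rintro (v | v) hvD hv
    · exact h5 v (mt Finset.mem_toLeft.1 hv)
    · simp [block] at hvD
  · rintro (v | v) hvD hv
    · exact h6 v (mt Finset.mem_toLeft.1 hv)
    · simp [block] at hvD

theorem exists_isPulsing_snd (hx : x.IsExecution P.d ϑ F) {T T' τ : ℝ}
    (hA : A₁.IsPulseSync P.d ϑ (P.blockFaults true) (2 * P.d) T T' τ)
    (hF : F.toRight.card ≤ P.blockFaults true)
    (hcard : 3 * P.blockFaults true < Fintype.card W₁) (hd : 1000 * P.d ≤ T)
    (hT : T' ≤ 1.05 * T) :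
    ∃ t₀ q, t₀ ≤ τ ∧ q 0 ≤ t₀ + T' ∧
      IsPulsing F (block W₀ W₁ true) (P.blockFaults true) P.d T T' t₀ (blockPulses x) q := by
  obtain ⟨t₀, h0, hτ, hst⟩ := hA F.toRight hF _
    (hx.restrict (simulationSnd P A₀ A₁) fun w => Finset.mem_toRight)
  obtain ⟨w₀, -, hw₀⟩ := Finset.exists_mem_notMem_of_card_lt_card
    (show F.toRight.card < (Finset.univ : Finset W₁).card by rw [Finset.card_univ]; omega)
  obtain ⟨q, h1, h2, h3, h4, h5, h6⟩ := hst.exists_windows hw₀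
  refine ⟨t₀, q, hτ, h2, ⟨?_, ?_, h0, h1, h3, h4, ?_, ?_, hd, hT⟩⟩
  · rwa [card_block_true_inter]
  · rwa [block_true_eq, Finset.card_map, Finset.card_univ]
  · rintro (v | v) hvD hv
    · simp [block] at hvD
    · exact h5 v (mt Finset.mem_toRight.1 hv)
  · rintro (v | v) hvD hv
    · simp [block] at hvD
    · exact h6 v (mt Finset.mem_toRight.1 hv)

/-- Once the block `i` has stabilised, one of its next pulses is not disturbed by the other block. -/
theorem exists_goodResyncAt (hx : x.IsExecution P.d ϑ F) (hϑ : ϑ ≤ 1.004)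
    (hF : F.card ≤ P.faults) (hcard : 3 * P.faults < Fintype.card (W₀ ⊕ W₁)) {i : Bool}
    {T T' t₀ Ψ : ℝ} {q : ℕ → ℝ}
    (hp : IsPulsing F (block W₀ W₁ i) (P.blockFaults i) P.d T T' t₀ (blockPulses x) q)
    (hlo : P.lo i = T - 4 * P.d) (hhi : P.hi i = 1.004 * (T' + 5 * P.d)) (hΨ : 0 < Ψ)
    (hΨT : 100 * Ψ ≤ T) (hhi' : P.hi (!i) + 30 * P.d ≤ 4 * T)
    (hfar : 1.004 * (T' + 35 * P.d + Ψ) < P.lo (!i) ∨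
      P.hi (!i) < T - 36 * P.d - Ψ ∧ 1.004 * (T' + 35 * P.d + Ψ) < 2 * P.lo (!i)) :
    ∃ t, 0 ≤ t ∧ t ≤ q 0 + 5 * T' ∧ x.GoodResyncAt F (5 * P.d) Ψ t := by
  have hd := P.d_pos
  have hV := isVoting hx hϑ hF hcard i
  have hV' := isVoting hx hϑ hF hcard (!i)
  have hT := hp.period_pos hV
  have hTd := hp.delay_le
  have h00 := hp.start_nonneg
  have h0 := hp.start_le
  have a1 := hp.step_le 0
  have a2 := hp.step_le 1
  have a3 := hp.step_le 2
  have a4 := hp.step_le 3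
  have a5 := hp.step_le 4
  have b1 := hp.le_step 0
  have b2 := hp.le_step 1
  have b3 := hp.le_step 2
  have b4 := hp.le_step 3
  have b5 := hp.le_step 4
  norm_num at a1 a2 a3 a4 a5 b1 b2 b3 b4 b5
  -- Block `i` makes each correct node trigger exactly once, so only a trigger on the other block
  -- can spoil the window.
  have key : ∀ k, 4 ≤ k → ¬ x.GoodResyncAt F (5 * P.d) Ψ (q k) → ∃ v, v ∉ F ∧
      ∃ r, (r ∈ x.updates v ∧ (!i) ∈ (st x v r).trigger) ∧ q k ≤ r ∧ r < q k + 5 * P.d + Ψ := by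
    intro k hk hbad
    by_contra hc
    push Not at hc
    refine hbad fun v hv => ?_
    obtain ⟨r, hr, h1, h2, huniq⟩ := hp.exists_unique_trigger hV hlo hhi hv hk
    refine ⟨r, (mem_pulses hx hv).2 ⟨i, hr⟩, ⟨h1, h2⟩, fun r' hr' hI => ?_⟩
    obtain ⟨j, hj⟩ := (mem_pulses hx hv).1 hr'
    by_cases hji : j = i
    · subst hji
      exact huniq r' hj hI.1 (by linarith [hI.2])
    · obtain rfl : j = !i := by revert hji; cases i <;> cases j <;> simp
      linarith [hc v hv r' hj hI.1, hI.2]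
  by_cases h4 : x.GoodResyncAt F (5 * P.d) Ψ (q 4)
  · exact ⟨q 4, by linarith, by linarith, h4⟩
  by_cases h5 : x.GoodResyncAt F (5 * P.d) Ψ (q 5)
  · exact ⟨q 5, by linarith, by linarith, h5⟩
  exfalso
  obtain ⟨v, hv, a, ha, ha1, ha2⟩ := key 4 le_rfl h4
  obtain ⟨w, hw, b, hb, hb1, hb2⟩ := key 5 (by norm_num) h5
  -- The two disturbances are one period of block `i` apart, up to `5 * d + Ψ`, which is a forbidden
  -- distance for the other block.
  obtain ⟨h1, h2⟩ := hV'.trigger_distance (P.hi_pos _) hv hw ha hb (by linarith) (by linarith)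
    (by linarith)
  rcases hfar with hfar | ⟨hfar, hfar'⟩
  · linarith
  · rcases h2 with h2 | h2 <;> linarith

/-- The resynchronisation algorithm works if block `true` pulses at `3 / 2` times the period of
block `false`. -/
theorem isResync (hϑ : ϑ ≤ 1.004) {S φ Ψ τ₀ τ₁ : ℝ} (hφ : 1 ≤ φ) (hφ' : φ ≤ 1.05) (hΨ : 0 < Ψ)
    (hSd : 1000 * P.d ≤ S) (hSΨ : 100 * Ψ ≤ S)
    (hlo₀ : P.lo false = S - 4 * P.d) (hhi₀ : P.hi false = 1.004 * (S * φ + 5 * P.d))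
    (hlo₁ : P.lo true = 1.5 * S - 4 * P.d)
    (hhi₁ : P.hi true = 1.004 * (1.5 * S * φ + 5 * P.d))
    (hA₀ : A₀.IsPulseSync P.d ϑ (P.blockFaults false) (2 * P.d) S (S * φ) τ₀)
    (hA₁ : A₁.IsPulseSync P.d ϑ (P.blockFaults true) (2 * P.d) (1.5 * S) (1.5 * S * φ) τ₁)
    (hcard : 3 * P.faults < Fintype.card (W₀ ⊕ W₁))
    (hcard₀ : 3 * P.blockFaults false < Fintype.card W₀)
    (hcard₁ : 3 * P.blockFaults true < Fintype.card W₁)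
    (hfaults : P.faults ≤ P.blockFaults false + P.blockFaults true + 1) :
    (resyncAlgorithm P A₀ A₁).IsResync P.d ϑ P.faults (5 * P.d) Ψ (max τ₀ τ₁ + 10 * S) := by
  intro F hF x hx
  have hd := P.d_pos
  have hS : 0 < S := by linarith
  have hSφ : S ≤ S * φ := le_mul_of_one_le_right hS.le hφ
  have hSφ' : S * φ ≤ 1.05 * S := by nlinarith
  have h15 : 1.5 * S * φ = 1.5 * (S * φ) := by ring
  have hsum := Finset.card_toLeft_add_card_toRight (u := F)
  -- By `hfaults`, block `true` is within its fault bound whenever block `false` is not.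
  rcases Nat.lt_or_ge (P.blockFaults false) F.toLeft.card with hbad | hgood
  · obtain ⟨t₀, q, hτ, hq, hp⟩ := exists_isPulsing_snd hx hA₁ (by omega) hcard₁ (by linarith)
      (by linarith)
    obtain ⟨t, ht0, ht, hgood⟩ := exists_goodResyncAt hx hϑ hF hcard hp hlo₁ hhi₁ hΨ (by linarith)
      (by simp only [Bool.not_true, hhi₀]; linarith)
      -- The period `1.5 * S` exceeds the `hi` of the other block, about `S`, but is less than its
      -- `2 * lo`, about `2 * S`.
      (Or.inr (by
        simp only [Bool.not_true, hhi₀, hlo₀]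
        constructor <;> linarith))
    -- The time is at most `t₀ + 6 * T'`, and `6 * 1.5 * 1.05 < 10`.
    exact ⟨t, ht0, by linarith [le_max_right τ₀ τ₁], hgood⟩
  · obtain ⟨t₀, q, hτ, hq, hp⟩ := exists_isPulsing_fst hx hA₀ hgood hcard₀ (by linarith)
      (by linarith)
    obtain ⟨t, ht0, ht, hgood⟩ := exists_goodResyncAt hx hϑ hF hcard hp hlo₀ hhi₀ hΨ (by linarith)
      (by simp only [Bool.not_false, hhi₁]; linarith)
      -- The period `S` is too short for the other block, whose `lo` is about `1.5 * S`.
      (Or.inl (by simp only [Bool.not_false, hlo₁]; linarith))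
    exact ⟨t, ht0, by linarith [le_max_left τ₀ τ₁], hgood⟩

end Resync

/-! ### Numerical bounds and the choice of the parameters -/

theorem one_le_phiZero {ϑ : ℝ} (hϑ : 1 < ϑ) (hϑ' : ϑ ≤ 1.004) : 1 ≤ phiZero ϑ := by
  have hD : 0 < 2 + 2 * ϑ - 3 * ϑ ^ 2 := by nlinarith
  have : 0 ≤ 5 * (ϑ - 1) / (2 + 2 * ϑ - 3 * ϑ ^ 2) := div_nonneg (by linarith) hD.le
  unfold phiZero
  linarith

/-- The ratio 3/2 of the periods leaves so much room that any `φ` in `[1, 1.05]` works. The exact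
form of the threshold plays no other role. -/
theorem phiZero_lt {ϑ : ℝ} (hϑ : 1 < ϑ) (hϑ' : ϑ ≤ 1.004) : phiZero ϑ < 1.05 := by
  have hD : 0.9 < 2 + 2 * ϑ - 3 * ϑ ^ 2 := by nlinarith
  have : 5 * (ϑ - 1) / (2 + 2 * ϑ - 3 * ϑ ^ 2) < 0.05 := by
    rw [div_lt_iff₀ (by linarith)]
    linarith
  unfold phiZero
  linarith

/-- This is the pigeonhole bound: overloading both blocks would take `f₀ + f₁ + 2 > f` faults. -/
theorem le_floor_add_ceil (f : ℕ) (hf : 1 ≤ f) :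
    f ≤ ⌊((f : ℝ) - 1) / 2⌋₊ + ⌈((f : ℝ) - 1) / 2⌉₊ + 1 := by
  have h1 := Nat.lt_floor_add_one (((f : ℝ) - 1) / 2)
  have h2 := Nat.le_ceil (((f : ℝ) - 1) / 2)
  have h3 : f < 2 * ⌊((f : ℝ) - 1) / 2⌋₊ + 3 := by
    have : (f : ℝ) < ((2 * ⌊((f : ℝ) - 1) / 2⌋₊ + 3 : ℕ) : ℝ) := by
      push_cast
      linarith
    exact_mod_cast this
  have h4 : f ≤ 2 * ⌈((f : ℝ) - 1) / 2⌉₊ + 1 := by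
    have : (f : ℝ) ≤ ((2 * ⌈((f : ℝ) - 1) / 2⌉₊ + 1 : ℕ) : ℝ) := by
      push_cast
      linarith
    exact_mod_cast this
  omega

theorem theorem3 (ϑ : ℝ) (hϑ : 1 < ϑ) (hϑ' : ϑ ≤ 1.004) :
    ∃ φ₁ : ℝ, phiZero ϑ < φ₁ ∧ ∃ (Cρ : ℝ) (K : ℕ),
    ∀ φ : ℝ, phiZero ϑ < φ → φ < φ₁ →
    ∀ ψ₀ c : ℝ, 0 < ψ₀ → 0 < c →
    ∃ CT CS : ℝ,
    ∀ d Ψ T₀ : ℝ, 0 < d → ψ₀ * d ≤ Ψ → 0 < T₀ → T₀ ≤ c * Ψ →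
    ∀ f n₀ n₁ f₀ f₁ : ℕ, 1 ≤ f → f₀ = ⌊((f : ℝ) - 1) / 2⌋₊ → f₁ = ⌈((f : ℝ) - 1) / 2⌉₊ →
    3 * f < n₀ + n₁ → 3 * f₀ < n₀ → 3 * f₁ < n₁ →
    ∀ (A₀ : ℝ → Algorithm (Fin n₀)) (A₁ : ℝ → Algorithm (Fin n₁)) (τ₀ τ₁ : ℝ → ℝ),
    (∀ T ∈ Set.Icc T₀ (CT * Ψ), (A₀ T).IsPulseSync d ϑ f₀ (2 * d) T (T * φ) (τ₀ T)) →
    (∀ T ∈ Set.Icc T₀ (CT * Ψ), (A₁ T).IsPulseSync d ϑ f₁ (2 * d) T (T * φ) (τ₁ T)) →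
    ∃ S₀ ∈ Set.Icc T₀ (CT * Ψ), ∃ S₁ ∈ Set.Icc T₀ (CT * Ψ),
    ∃ (B : Algorithm (Fin n₀ ⊕ Fin n₁)) (ρ : ℝ), 0 < ρ ∧ ρ ≤ Cρ * d ∧
      B.IsResync d ϑ f ρ Ψ (max (τ₀ S₀) (τ₁ S₁) + CS * Ψ) ∧
      B.bitRate d ϑ ≤ max ((A₀ S₀).bitRate d ϑ) ((A₁ S₁).bitRate d ϑ) + K ∧
      B.streams ≤ max (A₀ S₀).streams (A₁ S₁).streams + K := by
  refine ⟨1.05, phiZero_lt hϑ hϑ', 5, 15, fun φ hφ hφ' ψ₀ c hψ₀ hc => ?_⟩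
  have hφ1 := (one_le_phiZero hϑ hϑ').trans hφ.le
  -- With `S = α * Ψ` the three summands ensure `T₀ ≤ S`, `100 * Ψ ≤ S` and `1000 * d ≤ S`. The
  -- upper limit `2 * α * Ψ` accommodates the other period `1.5 * S`.
  set α : ℝ := c + 100 + 1000 / ψ₀ with hα
  refine ⟨2 * α, 10 * α, fun d Ψ T₀ hd hΨd hT₀ hT₀c f n₀ n₁ f₀ f₁ hf hf₀ hf₁ hn hn₀ hn₁
    A₀ A₁ τ₀ τ₁ hA₀ hA₁ => ?_⟩
  have hΨ : 0 < Ψ := (mul_pos hψ₀ hd).trans_le hΨd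
  have hd1000 : 1000 * d ≤ 1000 / ψ₀ * Ψ := by
    rw [div_mul_eq_mul_div, le_div_iff₀ hψ₀]
    linarith
  have hS : α * Ψ = c * Ψ + 100 * Ψ + 1000 / ψ₀ * Ψ := by rw [hα]; ring
  have hcΨ := mul_pos hc hΨ
  have hmem₀ : α * Ψ ∈ Icc T₀ (2 * α * Ψ) := ⟨by linarith, by linarith⟩
  have hmem₁ : 1.5 * (α * Ψ) ∈ Icc T₀ (2 * α * Ψ) := ⟨by linarith, by linarith⟩
  have hSφ : 0 < α * Ψ * φ := mul_pos (by linarith) (by linarith)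
  have h15 : 1.5 * (α * Ψ) * φ = 1.5 * (α * Ψ * φ) := by ring
  let P : ResyncParams :=
    { d := d
      lo := fun i => cond i (1.5 * (α * Ψ) - 4 * d) (α * Ψ - 4 * d)
      hi := fun i => cond i (1.004 * (1.5 * (α * Ψ) * φ + 5 * d)) (1.004 * (α * Ψ * φ + 5 * d))
      faults := f
      blockFaults := fun i => cond i f₁ f₀
      d_pos := hd
      lo_pos := fun i => by cases i <;> simp only [cond_true, cond_false] <;> linarith
      hi_pos := fun i => by cases i <;> simp only [cond_true, cond_false] <;> linarith }
  refine ⟨_, hmem₀, _, hmem₁, resyncAlgorithm P (A₀ (α * Ψ)) (A₁ (1.5 * (α * Ψ))), 5 * d,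
    by linarith, le_rfl, ?_, Resync.bitRate_le P _ _ hϑ', ?_⟩
  · have h := Resync.isResync (P := P) (S := α * Ψ) (φ := φ) (Ψ := Ψ) hϑ' hφ1 hφ'.le hΨ
      (show 1000 * d ≤ _ by linarith) (by linarith) rfl rfl rfl rfl (hA₀ _ hmem₀) (hA₁ _ hmem₁)
      (by simpa using hn)
      (show 3 * f₀ < Fintype.card (Fin n₀) by rwa [Fintype.card_fin])
      (show 3 * f₁ < Fintype.card (Fin n₁) by rwa [Fintype.card_fin])
      (show f ≤ f₀ + f₁ + 1 by rw [hf₀, hf₁]; exact le_floor_add_ceil f hf)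
    rw [mul_assoc]
    exact h
  · change max _ _ + 1 ≤ max _ _ + 15
    omega
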